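/- Let $G$ be a finite metabelian group, $A$ a maximal abelian subgroup of $G$ containing $G'$, and $F$ a number field. Notation. For subgroups $K\trianglelefteq H\le G$ with $H/K$ cyclic of order $k=[H:K]$, let $\mathcal C_F(H/K)$ be the set of orbits of the faithful linear characters of $H/K$ (with values in $F(\zeta_k)$) under $\mathrm{Gal}(F(\zeta_k)/F)$. For $C\in\mathcal C_F(H/K)$ and $\chi\in C$ put $$\varepsilon_C(H,K)=\frac1{|H|}\sum_{h\in H}\mathrm{tr}_{F(\zeta_k)/F}(\chi(hK))\,h^{-1}\in FG,$$ which does not depend on the choice of $\chi\in C$, and let $e_C(G,H,K)$ be the sum of the different $G$-conjugates $g^{-1}\varepsilon_C(H,K)g$ of $\varepsilon_C(H,K)$. The group $N_G(H)\cap N_G(K)$ acts on $\mathcal C_F(H/K)$ through $\chi\mapsto\chi^g$, $\chi^g(h)=\chi(ghg^{-1})$; let $E=E_F(G,H/K)$ be the stabilizer of $C$ (it is the same for all $C$). Consider the pairs $(H,K)$ of subgroups of $G$ such that (1) $H$ is a maximal element of the set $\{B\le G\mid A\le B \text{ and } B'\le K\le B\}$; (2) $H/K$ is cyclic. Then every primitive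 central idempotent of $FG$ is of the form $e_C(G,H,K)$ for some pair $(H,K)$ satisfying (1) and (2) and some $C\in\mathcal C_F(H/K)$. Furthermore, for every pair $(H,K)$ satisfying (1) and (2) and every $C\in\mathcal C_F(H/K)$, the element $e_C(G,H,K)$ is a primitive central idempotent of $FG$ and, with $k=[H:K]$, there is an isomorphism of $F$-algebras $$FG\,e_C(G,H,K)\simeq M_{[G:E]}\bigl(F(\zeta_k)*_\tau^\sigma E/H\bigr).$$ Here $yK$ is any generator of $H/K$, $\zeta_k=\chi(yK)$ for any $\chi\in C$ (a primitive $k$-th root of unity), $\phi:E/H\to E/K$ is any section of the projection $E/K\to E/H$, the automorphisms $\sigma_q$ of $F(\zeta_k)$ over $F$ and the units $\tau(p,q)$, for $p,q\in E/H$, are determined by $$\sigma_q(\zeta_k)=\zeta_k^i \text{ if } \phi(q)^{-1}\,yK\,\phi(q)=y^iK,\qquad \tau(p,q)=\zeta_k^j \text{ if } \phi(pq)^{-1}\phi(p)\phi(q)=y^jK,$$ and the crossed product $F(\zeta_k)*_\tau^\sigma E/H$ is the $F$-algebra with basis $(u_q)_{q\in E/H}$ as a right $F(\zeta_k)$-vector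 space and multiplication $a\,u_q=u_q\,\sigma_q(a)$ for $a\in F(\zeta_k)$, $u_p\,u_q=u_{pq}\,\tau(p,q)$. -/

import Mathlib

/-! ### Primitive central idempotents and corner algebras -/

/-- `e` is a primitive central idempotent of the ring `R`: a nonzero central idempotent which is
not the sum of two nonzero orthogonal central idempotents. -/
def IsPrimitiveCentralIdempotent {R : Type*} [Ring R] (e : R) : Prop :=
  IsIdempotentElem e ∧ e ∈ Set.center R ∧ e ≠ 0 ∧
    ∀ f f' : R, IsIdempotentElem f → f ∈ Set.center R → IsIdempotentElem f' → f' ∈ Set.center R →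
      f * f' = 0 → f + f' = e → f = 0 ∨ f' = 0

section Corner

variable {F R : Type*} [Field F] [Ring R] [Algebra F R] {e : R}

/-- The `F`-algebra structure of the ring `e R e` (with identity `e`), by restriction of the
scalar multiplication of `R`. If `e` is central, then `e R e = R e`. -/
instance cornerSMul (he : IsIdempotentElem e) : SMul F he.Corner where
  smul r x := ⟨r • x.1, by
    obtain ⟨y, hy⟩ := x.2
    exact ⟨r • y, by rw [← hy]; simp⟩⟩

theorem corner_coe_smul (he : IsIdempotentElem e) (r : F) (x : he.Corner) :
    (r • x).1 = r • x.1 := rfl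

instance cornerModule (he : IsIdempotentElem e) : Module F he.Corner where
  one_smul x := Subtype.ext (one_smul F x.1)
  mul_smul r s x := Subtype.ext (mul_smul r s x.1)
  smul_zero r := Subtype.ext (smul_zero r)
  smul_add r x y := Subtype.ext (smul_add r x.1 y.1)
  add_smul r s x := Subtype.ext (add_smul r s x.1)
  zero_smul x := Subtype.ext (zero_smul F x.1)

noncomputable instance cornerAlgebra (he : IsIdempotentElem e) : Algebra F he.Corner :=
  Algebra.ofModule (fun r x y => Subtype.ext (smul_mul_assoc r x.1 y.1))
    (fun r x y => Subtype.ext (mul_smul_comm r x.1 y.1))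

end Corner

/-! ### Crossed products -/

/-- The data of a crossed product of the commutative `F`-algebra `L` by the group `Q`:
an action `σ` of `Q` on `L` and a twisting `τ : Q × Q → Lˣ`. They are normalised for a
homogeneous basis `(u_q)` of units over which the coefficients stand on the right, that is
`a u_q = u_q σ_q(a)` and `u_p u_q = u_{pq} τ(p,q)`; the two conditions express that such a
multiplication is associative. -/
@[ext]
structure CrossedSystem (F L Q : Type*) [Field F] [Field L] [Algebra F L] [Group Q] where
  σ : Q → (L ≃ₐ[F] L)
  τ : Q → Q → Lˣ
  σ_mul : ∀ p q a, σ (p * q) a = σ q (σ p a)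
  τ_mul : ∀ p q r, (τ (p * q) r : L) * σ r (τ p q) = τ p (q * r) * τ q r

/-- The crossed product `L *_τ^σ Q`: the right `L`-vector space with basis `(u_q)`, whose element
`∑ u_q a_q` is stored as the finitely supported function `q ↦ a_q`. -/
def CrossedProduct {F L Q : Type*} [Field F] [Field L] [Algebra F L] [Group Q]
    (_S : CrossedSystem F L Q) : Type _ := Q →₀ L

namespace CrossedProduct

variable {F L Q : Type*} [Field F] [Field L] [Algebra F L] [Group Q] (S : CrossedSystem F L Q)

noncomputable instance : AddCommGroup (CrossedProduct S) := inferInstanceAs (AddCommGroup (Q →₀ L))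

noncomputable instance : Module F (CrossedProduct S) := inferInstanceAs (Module F (Q →₀ L))

/-- The homogeneous element `u_q a`. -/
noncomputable def single (q : Q) : L →+ CrossedProduct S := Finsupp.singleAddHom q

/-- `(u_p a) (u_q b) = u_{pq} τ(p,q) σ_q(a) b`, extended biadditively. -/
noncomputable def mulHom : CrossedProduct S →+ CrossedProduct S →+ CrossedProduct S :=
  Finsupp.liftAddHom fun p : Q => AddMonoidHom.flip <| Finsupp.liftAddHom fun q : Q =>
    AddMonoidHom.flip <|
      (AddMonoidHom.compHom (single S (p * q))).comp <|
        AddMonoidHom.mul.comp <|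
          (AddMonoidHom.mulLeft (S.τ p q : L)).comp ((S.σ q : L →+* L) : L →+ L)

noncomputable instance : Mul (CrossedProduct S) := ⟨fun x y => mulHom S x y⟩

noncomputable instance : One (CrossedProduct S) := ⟨single S 1 ((S.τ 1 1)⁻¹ : Lˣ)⟩

variable {S}

theorem mul_def (x y : CrossedProduct S) : x * y = mulHom S x y := rfl

theorem single_mul_single (p q : Q) (a b : L) :
    single S p a * single S q b = single S (p * q) (S.τ p q * S.σ q a * b) := by
  have h1 := Finsupp.liftAddHom_apply_single (fun p : Q => AddMonoidHom.flip <|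
    Finsupp.liftAddHom fun q : Q => AddMonoidHom.flip <|
      (AddMonoidHom.compHom (single S (p * q))).comp <|
        AddMonoidHom.mul.comp <|
          (AddMonoidHom.mulLeft (S.τ p q : L)).comp ((S.σ q : L →+* L) : L →+ L)) p a
  have h2 := DFunLike.congr_fun h1 (Finsupp.single q b)
  refine h2.trans ?_
  rw [AddMonoidHom.flip_apply, Finsupp.liftAddHom_apply_single]
  rfl

theorem one_def : (1 : CrossedProduct S) = single S 1 ((S.τ 1 1)⁻¹ : Lˣ) := rfl

theorem smul_single (r : F) (q : Q) (a : L) : r • single S q a = single S q (r • a) :=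
  Finsupp.smul_single r q a

theorem induction {P : CrossedProduct S → Prop} (x : CrossedProduct S) (h0 : P 0)
    (ha : ∀ x y, P x → P y → P (x + y)) (hs : ∀ q a, P (single S q a)) : P x :=
  Finsupp.induction_linear (motive := P) x h0 ha hs

theorem σ_one (a : L) : S.σ 1 a = a := by
  have h := S.σ_mul 1 1 a
  rw [one_mul] at h
  exact ((S.σ 1).injective h).symm

theorem σ_τ_one (q : Q) : S.σ q (S.τ 1 1) = S.τ 1 q := by
  have h := S.τ_mul 1 1 q
  rw [one_mul, one_mul] at h
  exact mul_left_cancel₀ (S.τ 1 q).ne_zero h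

theorem τ_one (q : Q) : (S.τ q 1 : L) = S.τ 1 1 := by
  have h := S.τ_mul q 1 1
  rw [mul_one, mul_one, σ_one] at h
  exact mul_left_cancel₀ (S.τ q 1).ne_zero h

protected theorem left_distrib' (x y z : CrossedProduct S) : x * (y + z) = x * y + x * z :=
  map_add (mulHom S x) y z

protected theorem right_distrib' (x y z : CrossedProduct S) : (x + y) * z = x * z + y * z := by
  simp [mul_def]

protected theorem zero_mul' (x : CrossedProduct S) : 0 * x = 0 := by simp [mul_def]

protected theorem mul_zero' (x : CrossedProduct S) : x * 0 = 0 := by simp [mul_def]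

protected theorem one_mul' (x : CrossedProduct S) : 1 * x = x := by
  induction x using CrossedProduct.induction with
  | h0 => exact CrossedProduct.mul_zero' _
  | ha x y hx hy => rw [CrossedProduct.left_distrib', hx, hy]
  | hs q a =>
    rw [one_def, single_mul_single, one_mul, ← σ_τ_one, ← map_mul, Units.mul_inv, map_one, one_mul]

protected theorem mul_one' (x : CrossedProduct S) : x * 1 = x := by
  induction x using CrossedProduct.induction with
  | h0 => exact CrossedProduct.zero_mul' _
  | ha x y hx hy => rw [CrossedProduct.right_distrib', hx, hy]
  | hs q a =>
    rw [one_def, single_mul_single, mul_one, τ_one, σ_one, mul_right_comm, Units.mul_inv, one_mul]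

protected theorem mul_assoc' (x y z : CrossedProduct S) : x * y * z = x * (y * z) := by
  induction x using CrossedProduct.induction with
  | h0 => simp only [CrossedProduct.zero_mul']
  | ha x x' hx hx' => simp only [CrossedProduct.right_distrib', hx, hx']
  | hs p a =>
  induction y using CrossedProduct.induction with
  | h0 => simp only [CrossedProduct.zero_mul', CrossedProduct.mul_zero']
  | ha y y' hy hy' => simp only [CrossedProduct.right_distrib', CrossedProduct.left_distrib', hy, hy']
  | hs q b =>
  induction z using CrossedProduct.induction with
  | h0 => simp only [CrossedProduct.mul_zero']
  | ha z z' hz hz' => simp only [CrossedProduct.left_distrib', hz, hz']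
  | hs r c =>
    simp only [single_mul_single, mul_assoc, map_mul, S.σ_mul]
    congr 1
    linear_combination (S.σ r (S.σ q a) * S.σ r b * c) * S.τ_mul p q r

noncomputable instance : Ring (CrossedProduct S) where
  left_distrib := CrossedProduct.left_distrib'
  right_distrib := CrossedProduct.right_distrib'
  zero_mul := CrossedProduct.zero_mul'
  mul_zero := CrossedProduct.mul_zero'
  mul_assoc := CrossedProduct.mul_assoc'
  one_mul := CrossedProduct.one_mul'
  mul_one := CrossedProduct.mul_one'
  neg_add_cancel := neg_add_cancel
  zsmul := fun n x => n • x
  zsmul_zero' := SubNegMonoid.zsmul_zero'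
  zsmul_succ' := SubNegMonoid.zsmul_succ'
  zsmul_neg' := SubNegMonoid.zsmul_neg'
  sub_eq_add_neg := sub_eq_add_neg

protected theorem smul_mul' (r : F) (x y : CrossedProduct S) : r • x * y = r • (x * y) := by
  induction x using CrossedProduct.induction with
  | h0 => simp
  | ha x x' hx hx' => simp only [smul_add, add_mul, hx, hx']
  | hs p a =>
  induction y using CrossedProduct.induction with
  | h0 => simp
  | ha y y' hy hy' => simp only [smul_add, mul_add, hy, hy']
  | hs q b => simp only [smul_single, single_mul_single, map_smul, mul_smul_comm, smul_mul_assoc]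

protected theorem mul_smul' (r : F) (x y : CrossedProduct S) : x * r • y = r • (x * y) := by
  induction x using CrossedProduct.induction with
  | h0 => simp
  | ha x x' hx hx' => simp only [smul_add, add_mul, hx, hx']
  | hs p a =>
  induction y using CrossedProduct.induction with
  | h0 => simp
  | ha y y' hy hy' => simp only [smul_add, mul_add, hy, hy']
  | hs q b => simp only [smul_single, single_mul_single, mul_smul_comm]

noncomputable instance : Algebra F (CrossedProduct S) :=
  Algebra.ofModule CrossedProduct.smul_mul' CrossedProduct.mul_smul'

end CrossedProduct

/-! ### Faithful characters of `H/K` and their Galois classes -/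

section Idempotents

variable (F : Type*) [Field F] {G : Type*} [Group G] (H K : Subgroup G)

/-- The field `F(ζ_k)` with `k = [H : K]`. -/
abbrev CycField : Type _ := CyclotomicField (K.relIndex H) F

/-- The linear characters of `H` with kernel `K`, which are the same thing as the faithful linear
characters of `H/K`. For `H/K` cyclic of order `k` their values are `k`-th roots of unity, so that
they can be taken in `F(ζ_k)`. -/
abbrev FaithfulChar : Type _ :=
  {χ : H →* (CycField F H K)ˣ // χ.ker = K.subgroupOf H}

variable {F H K}

/-- Two characters are related if they lie in the same orbit of `Gal(F(ζ_k)/F)`, which acts on the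
values of the characters. -/
def galRel (χ ψ : FaithfulChar F H K) : Prop :=
  ∃ s : CycField F H K ≃ₐ[F] CycField F H K,
    ∀ h : H, (ψ.1 h : CycField F H K) = s (χ.1 h)

variable (F H K) in
/-- The orbit equivalence relation of `Gal(F(ζ_k)/F)`. -/
def galSetoid : Setoid (FaithfulChar F H K) where
  r := galRel
  iseqv :=
    { refl := fun _ => ⟨AlgEquiv.refl, fun _ => rfl⟩
      symm := fun ⟨s, hs⟩ => ⟨s.symm, fun h => by rw [hs h, AlgEquiv.symm_apply_apply]⟩
      trans := fun ⟨s, hs⟩ ⟨t, ht⟩ => ⟨s.trans t, fun h => by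
        rw [ht h, hs h, AlgEquiv.trans_apply]⟩ }

variable (F H K) in
/-- The set `𝒞_F(H/K)` of the orbits of the faithful characters of `H/K` under
`Gal(F(ζ_k)/F)`. -/
abbrev CharClass : Type _ := Quotient (galSetoid F H K)

/-- The class of a character. -/
def charClass (χ : FaithfulChar F H K) : CharClass F H K := Quotient.mk (galSetoid F H K) χ

/-- `|H|⁻¹ ∑_{h ∈ H} tr(χ(hK)) h⁻¹`, where `tr` is the trace of `F(ζ_k)/F`. -/
noncomputable def epsChar (χ : FaithfulChar F H K) : MonoidAlgebra F G :=
  ∑ᶠ h : H, MonoidAlgebra.single ((h : G)⁻¹)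
    ((Nat.card H : F)⁻¹ * Algebra.trace F (CycField F H K) (χ.1 h))

theorem epsChar_eq_of_galRel {χ ψ : FaithfulChar F H K} (h : galRel χ ψ) :
    epsChar χ = epsChar ψ := by
  obtain ⟨s, hs⟩ := h
  unfold epsChar
  simp only [hs, Algebra.trace_eq_of_algEquiv]

/-- The element `ε_C(H,K)` of `FG`. -/
noncomputable def epsClass (C : CharClass F H K) : MonoidAlgebra F G :=
  Quotient.lift (s := galSetoid F H K) epsChar (fun _ _ h => epsChar_eq_of_galRel h) C

/-- The element `e_C(G,H,K)` of `FG`: the sum of the different `G`-conjugates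
`g⁻¹ ε_C(H,K) g` of `ε_C(H,K)`. -/
noncomputable def eClass (C : CharClass F H K) : MonoidAlgebra F G :=
  ∑ᶠ x ∈ Set.range (fun g : G =>
    MonoidAlgebra.single g⁻¹ (1 : F) * epsClass C * MonoidAlgebra.single g (1 : F)), x

/-! ### The stabilizer `E_F(G,H/K)` -/

/-- The subgroup `N = N_G(H) ∩ N_G(K)`. -/
abbrev bothNormalizer (H K : Subgroup G) : Subgroup G :=
  Subgroup.normalizer (H : Set G) ⊓ Subgroup.normalizer (K : Set G)

/-- The conjugation `h ↦ g h g⁻¹` of `H` by `g ∈ N`. -/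
def conjHom (g : bothNormalizer H K) : H →* H where
  toFun h := ⟨g * h * (g : G)⁻¹, (Subgroup.mem_normalizer_iff.mp g.2.1 h).mp h.2⟩
  map_one' := Subtype.ext (by simp)
  map_mul' x y := Subtype.ext (by simp [mul_assoc])

/-- The conjugate character `χ^g`, for `g ∈ N`: it is given by `χ^g (g⁻¹ h g) = χ(h)`, that is
`χ^g (h) = χ(g h g⁻¹)`. -/
noncomputable def conjChar (g : bothNormalizer H K) (χ : FaithfulChar F H K) : FaithfulChar F H K :=
  ⟨χ.1.comp (conjHom g), by
    ext h
    have h1 : conjHom g h ∈ χ.1.ker ↔ conjHom g h ∈ K.subgroupOf H := by rw [χ.2]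
    have h2 := Subgroup.mem_normalizer_iff.mp g.2.2 (h : G)
    rw [MonoidHom.mem_ker, Subgroup.mem_subgroupOf] at h1
    rw [MonoidHom.mem_ker, Subgroup.mem_subgroupOf]
    exact h1.trans h2.symm⟩

/-- The (right) action of `N` on `𝒞_F(H/K)`. -/
noncomputable def conjClass (g : bothNormalizer H K) (C : CharClass F H K) : CharClass F H K :=
  Quotient.map (sa := galSetoid F H K) (sb := galSetoid F H K) (conjChar g)
    (fun _ _ ⟨s, hs⟩ => ⟨s, fun h => hs (conjHom g h)⟩) C

theorem conjClass_one (C : CharClass F H K) : conjClass 1 C = C := by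
  induction C using Quotient.inductionOn with
  | h χ =>
    refine congrArg (Quotient.mk (galSetoid F H K)) (Subtype.ext (MonoidHom.ext fun h => ?_))
    exact congrArg χ.1 (Subtype.ext (by simp [conjHom]))

theorem conjClass_mul (g g' : bothNormalizer H K) (C : CharClass F H K) :
    conjClass (g * g') C = conjClass g' (conjClass g C) := by
  induction C using Quotient.inductionOn with
  | h χ =>
    refine congrArg (Quotient.mk (galSetoid F H K)) (Subtype.ext (MonoidHom.ext fun h => ?_))
    exact congrArg χ.1 (Subtype.ext (by simp [conjHom, mul_assoc]))

/-- The group `E = E_F(G,H/K)`: the stabilizer of `C` under the action of `N` on `𝒞_F(H/K)`.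
For `H/K` cyclic it is the same for all `C`. -/
def stabE (C : CharClass F H K) : Subgroup G where
  carrier := {g | ∃ hg : g ∈ bothNormalizer H K, conjClass ⟨g, hg⟩ C = C}
  one_mem' := ⟨one_mem _, conjClass_one C⟩
  mul_mem' := by
    rintro a b ⟨ha, ha'⟩ ⟨hb, hb'⟩
    refine ⟨mul_mem ha hb, ?_⟩
    have := conjClass_mul ⟨a, ha⟩ ⟨b, hb⟩ C
    rw [ha', hb'] at this
    exact this
  inv_mem' := by
    rintro a ⟨ha, ha'⟩
    refine ⟨inv_mem ha, ?_⟩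
    have := conjClass_mul ⟨a, ha⟩ ⟨a, ha⟩⁻¹ C
    rw [ha', mul_inv_cancel, conjClass_one] at this
    exact this.symm

theorem stabE_le (C : CharClass F H K) : stabE C ≤ bothNormalizer H K := fun _ hg => hg.1

theorem le_stabE (hK : K ≤ H) (hH : ⁅H, H⁆ ≤ K) (C : CharClass F H K) : H ≤ stabE C := by
  intro g hg
  have hn : g ∈ bothNormalizer H K := by
    refine ⟨Subgroup.le_normalizer hg, Subgroup.le_normalizer_iff_commutator_le_right.mpr ?_ hg⟩
    exact (Subgroup.commutator_mono le_rfl hK).trans hH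
  refine ⟨hn, ?_⟩
  induction C using Quotient.inductionOn with
  | h χ =>
    refine congrArg (Quotient.mk (galSetoid F H K)) (Subtype.ext (MonoidHom.ext fun h => ?_))
    have : conjHom ⟨g, hn⟩ h = ⟨g, hg⟩ * h * ⟨g, hg⟩⁻¹ := rfl
    change χ.1 (conjHom ⟨g, hn⟩ h) = χ.1 h
    rw [this, map_mul, map_mul, map_inv, mul_comm (χ.1 _), mul_inv_cancel_right]

instance stabE_normal_left (C : CharClass F H K) : (H.subgroupOf (stabE C)).Normal :=
  Subgroup.normal_subgroupOf_of_le_normalizer ((stabE_le C).trans inf_le_left)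

instance stabE_normal_right (C : CharClass F H K) : (K.subgroupOf (stabE C)).Normal :=
  Subgroup.normal_subgroupOf_of_le_normalizer ((stabE_le C).trans inf_le_right)

/-- The group `E/H`. -/
abbrev QuotEH (C : CharClass F H K) : Type _ := stabE C ⧸ H.subgroupOf (stabE C)

/-- The group `E/K`. -/
abbrev QuotEK (C : CharClass F H K) : Type _ := stabE C ⧸ K.subgroupOf (stabE C)

/-- `φ : E/H → E/K` is a section of the projection `E/K → E/H`: every representative in `E` of
`φ(q)` is a representative of `q`. -/
def IsSection (C : CharClass F H K) (φ : QuotEH C → QuotEK C) : Prop :=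
  ∀ (q : QuotEH C) (g : stabE C), (g : QuotEK C) = φ q → (g : QuotEH C) = q

/-- The action `σ` and the twisting `τ` of `S` are the ones attached to a section `φ`, a
generator `yK` of `H/K` and a root of unity `ζ = ζ_k`:
`σ_q(ζ_k) = ζ_k^i` if `φ(q)⁻¹ yK φ(q) = y^i K`, and
`τ(p,q) = ζ_k^j` if `φ(pq)⁻¹ φ(p) φ(q) = y^j K`.
As `ζ_k` generates `F(ζ_k)` over `F`, these formulas determine `σ` and `τ`. -/
structure CrossedSystem.IsAttached {C : CharClass F H K}
    (S : CrossedSystem F (CycField F H K) (QuotEH C))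
    (φ : QuotEH C → QuotEK C) (y : stabE C) (ζ : CycField F H K) : Prop where
  σ_eq : ∀ (q : QuotEH C) (i : ℤ),
    (φ q)⁻¹ * (y : QuotEK C) * φ q = (y : QuotEK C) ^ i → S.σ q ζ = ζ ^ i
  τ_eq : ∀ (p q : QuotEH C) (j : ℤ),
    (φ (p * q))⁻¹ * φ p * φ q = (y : QuotEK C) ^ j → (S.τ p q : CycField F H K) = ζ ^ j

end Idempotents

/-! ### The pairs of subgroups -/

/-- The conditions on `(H,K)`: `H` is a maximal element of the set of the subgroups `B` of `G` with
`A ≤ B` and `B' ≤ K ≤ B`, and `H/K` is cyclic. -/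
def IsCyclicMaximalPair {G : Type*} [Group G] (A H K : Subgroup G) : Prop :=
  Maximal (fun B : Subgroup G => A ≤ B ∧ ⁅B, B⁆ ≤ K ∧ K ≤ B) H ∧
    ∃ _ : (K.subgroupOf H).Normal, IsCyclic (H ⧸ K.subgroupOf H)

/-!
The theorem is proved by realising everything inside `FG` explicitly.

Let `L = F(ζ_k)` and let `χ : H → Lˣ` be a character whose values generate `L`. The map
`charEmb χ : a ↦ |H|⁻¹ ∑_h tr(a χ(h)⁻¹) h` satisfies `h · charEmb χ a = charEmb χ (χ(h) a)`, and
since the trace is the sum over the Galois group, orthogonality of characters makes it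
multiplicative (`charEmb_mul`). It identifies `L` with the ideal `FH ε` of `FH`, where
`ε = charEmb χ 1 = ε_C`, and for characters which are not Galois conjugate the ideals annihilate
each other (`charEmb_mul_charEmb_eq_zero`). As `H` contains `G'` it is normal, so a conjugate of `ε`
is the idempotent of a conjugate of `χ`: two conjugates are equal or orthogonal, and the stabilizer
of `ε` is `E`. Moreover `charEmb χ a · g = g · charEmb χ (σ_g a)` for `g ∈ E`, where
`σ_g (χ(h)) = χ(g⁻¹ h g)` (`charEmb_mul_of`).

Hence `u_q a ↦ r(q) · charEmb χ a`, for representatives `r(q)` of the elements of `E/H`, is an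
isomorphism of the crossed product onto the corner `ε FG ε` (`crossedEmb_mul`,
`crossedEmb_injective`, `exists_crossedEmb_eq`), and the orthogonal conjugates of `ε` provide matrix
units which identify the corner of `e_C` with matrices over it
(`nonempty_corner_algEquiv_matrix`).

Maximality of `H` says that no element outside `H` centralizes `H/K`
(`mem_of_isTwist_refl`), so `E/H` acts faithfully on `L`. The crossed product then has no central
idempotents except `0` and `1`, and `e_C` is primitive (`isPrimitiveCentralIdempotent_eClass`).

Conversely, let `e` be a primitive central idempotent. A nonzero element fixed by `K ⊇ B'` is not
annihilated by the idempotents of all the characters of `B/K` (`exists_epsChar_mul_ne_zero`). For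
`B = A` and `K = 1` this gives a character whose idempotent does not annihilate `e`; choose such a
character on a subgroup `H ⊇ A` which is as large as possible, with kernel `K`. If `H` were not
maximal for `K`, the same lemma would produce a character on a larger subgroup. So `(H, K)` is one
of the pairs, `e e_C ≠ 0`, and `e = e_C` by primitivity.
-/

/-! ### Matrix units in corner algebras -/

section MatrixUnits

variable {F R T : Type*} [Field F] [Ring R] [Algebra F R] [Ring T] [Algebra F T]
  {ι : Type*} [Fintype ι] [DecidableEq ι] {ε : R} {a b : ι → R}

/-- The sums `∑ bᵢ aᵢ` with `aᵢ bⱼ = δᵢⱼ ε` are idempotent. -/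
theorem isIdempotentElem_sum_matrixUnits (hab : ∀ i j, a i * b j = if i = j then ε else 0)
    (ha : ∀ i, ε * a i = a i) : IsIdempotentElem (∑ i, b i * a i) := by
  have h : ∀ i j, b i * a i * (b j * a j) = if i = j then b i * a i else 0 := fun i j => by
    rw [mul_assoc, ← mul_assoc (a i), hab]
    split_ifs with h
    · rw [← h, ha]
    · simp
  simp [IsIdempotentElem, Finset.sum_mul_sum, h]

/-- If `aᵢ bⱼ = δᵢⱼ ε` and `Θ` identifies the algebra `T` with the corner `ε R ε`, then the corner
of the idempotent `∑ bᵢ aᵢ` is a matrix algebra over `T`: the matrix `m` corresponds to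
`∑ bᵢ Θ(mᵢⱼ) aⱼ`. -/
theorem nonempty_corner_algEquiv_matrix (Θ : T →ₗ[F] R) (hmul : ∀ x y, Θ (x * y) = Θ x * Θ y)
    (hone : Θ 1 = ε) (hinj : Function.Injective Θ) (hsurj : ∀ x, ∃ z, Θ z = ε * x * ε)
    (hab : ∀ i j, a i * b j = if i = j then ε else 0) (ha : ∀ i, ε * a i = a i)
    (hb : ∀ i, b i * ε = b i) (he : IsIdempotentElem (∑ i, b i * a i)) :
    Nonempty (he.Corner ≃ₐ[F] Matrix ι ι T) := by
  have hl : ∀ z, ε * Θ z = Θ z := fun z => by rw [← hone, ← hmul, one_mul]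
  have hr : ∀ z, Θ z * ε = Θ z := fun z => by rw [← hone, ← hmul, mul_one]
  have hea : ∀ i, a i * ∑ j, b j * a j = a i := fun i => by
    simp [Finset.mul_sum, ← mul_assoc, hab, ha]
  have heb : ∀ i, (∑ j, b j * a j) * b i = b i := fun i => by
    simp [Finset.sum_mul, mul_assoc, hab, hb]
  let Ψ : Matrix ι ι T →ₗ[F] R :=
    { toFun := fun m => ∑ i, ∑ j, b i * Θ (m i j) * a j
      map_add' := fun m m' => by
        simp only [Matrix.add_apply, map_add, mul_add, add_mul, Finset.sum_add_distrib]
      map_smul' := fun r m => by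
        simp only [Matrix.smul_apply, map_smul, mul_smul_comm, smul_mul_assoc, Finset.smul_sum,
          RingHom.id_apply] }
  have hΨ : ∀ m, Ψ m = ∑ i, ∑ j, b i * Θ (m i j) * a j := fun _ => rfl
  have hΨb : ∀ m j, Ψ m * b j = ∑ i, b i * Θ (m i j) := fun m j => by
    simp [hΨ, Finset.sum_mul, mul_assoc, hab, hr]
  have haΨ : ∀ m i, a i * Ψ m = ∑ j, Θ (m i j) * a j := fun m i => by
    simp [hΨ, Finset.mul_sum, ← mul_assoc, hab, hl, ite_mul]
  have haΨb : ∀ m i j, a i * Ψ m * b j = Θ (m i j) := fun m i j => by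
    rw [haΨ, Finset.sum_mul]
    simp [mul_assoc, hab, hr]
  have hΨmul : ∀ m m', Ψ (m * m') = Ψ m * Ψ m' := fun m m' => by
    rw [hΨ m', Finset.mul_sum, hΨ]
    simp only [Matrix.mul_apply, map_sum, hmul, Finset.mul_sum, Finset.sum_mul, ← mul_assoc, hΨb]
    rw [Finset.sum_comm]
    conv_rhs => rw [Finset.sum_comm]
    refine Finset.sum_congr rfl fun j _ => ?_
    rw [Finset.sum_comm]
  have hΨone : Ψ 1 = ∑ i, b i * a i := by
    rw [hΨ]
    refine Finset.sum_congr rfl fun i _ => ?_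
    rw [Finset.sum_eq_single i]
    · rw [Matrix.one_apply_eq, hone, hb]
    · intro j _ hj
      rw [Matrix.one_apply_ne hj.symm]; simp
    · simp
  have hmem : ∀ m, Ψ m = (∑ i, b i * a i) * Ψ m * ∑ i, b i * a i := fun m => by
    rw [← hΨone, ← hΨmul, ← hΨmul, one_mul, mul_one]
  let f : Matrix ι ι T →ₗ[F] he.Corner :=
    { toFun := fun m => ⟨Ψ m, Ψ m, (hmem m).symm⟩
      map_add' := fun m m' => Subtype.ext (map_add Ψ m m')
      map_smul' := fun r m => Subtype.ext (map_smul Ψ r m) }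
  let g : Matrix ι ι T →ₐ[F] he.Corner :=
    AlgHom.ofLinearMap f (Subtype.ext hΨone) (fun m m' => Subtype.ext (hΨmul m m'))
  refine ⟨(AlgEquiv.ofBijective g ⟨fun m m' h => ?_, fun x => ?_⟩).symm⟩
  · have h' : Ψ m = Ψ m' := congrArg Subtype.val h
    ext i j
    apply hinj
    rw [← haΨb, ← haΨb, h']
  · obtain ⟨x, y, rfl⟩ := x
    choose z hz using hsurj
    refine ⟨Matrix.of fun i j => z (a i * y * b j), Subtype.ext ?_⟩
    change Ψ _ = (∑ i, b i * a i) * y * ∑ i, b i * a i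
    simp only [hΨ, Matrix.of_apply, hz, Finset.sum_mul, Finset.mul_sum]
    rw [Finset.sum_comm]
    refine Finset.sum_congr rfl fun j _ => Finset.sum_congr rfl fun i _ => ?_
    calc b i * (ε * (a i * y * b j) * ε) * a j = (b i * ε) * a i * y * b j * (ε * a j) := by
          simp only [mul_assoc]
      _ = b i * a i * y * (b j * a j) := by rw [hb, ha]; simp only [mul_assoc]

end MatrixUnits

/-! ### The embedding of `L` into the group algebra attached to a linear character -/

section CharEmbedding

open MonoidAlgebra

variable {F L G : Type*} [Field F] [Field L] [Algebra F L] [Group G] {H : Subgroup G} [Fintype H]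

/-- For a linear character `χ` of `H` with values in `L`, the map
`a ↦ |H|⁻¹ ∑_{h ∈ H} tr(a χ(h)⁻¹) h` from `L` to `FG`. -/
noncomputable def charEmb (χ : H →* Lˣ) : L →ₗ[F] MonoidAlgebra F G :=
  ∑ h : H, (lsingle (h : G)).comp
    ((Nat.card H : F)⁻¹ • (Algebra.trace F L).comp (LinearMap.mulRight F ((χ h)⁻¹ : Lˣ).1))

theorem charEmb_apply (χ : H →* Lˣ) (a : L) :
    charEmb (F := F) χ a = ∑ h : H, single (h : G)
      ((Nat.card H : F)⁻¹ * Algebra.trace F L (a * ((χ h)⁻¹ : Lˣ).1)) := by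
  simp [charEmb, LinearMap.sum_apply]

/-- `H` acts on the image of `charEmb χ` through `χ`. -/
theorem of_mul_charEmb (χ : H →* Lˣ) (h : H) (a : L) :
    of F G h * charEmb χ a = charEmb χ (χ h * a) := by
  simp only [charEmb_apply, Finset.mul_sum, of_apply, single_mul_single, one_mul]
  refine Fintype.sum_equiv (Equiv.mulLeft h) _ _ fun x => ?_
  simp only [Equiv.coe_mulLeft, Subgroup.coe_mul, map_mul, mul_inv_rev, Units.val_mul,
    Units.val_inv_eq_inv_val]
  congr 3
  field_simp

/-- The automorphism `s` of `L` turns the conjugate of `χ` by `g` into `ψ`: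
`g h g⁻¹ ∈ H` and `ψ(h) = s(χ(g h g⁻¹))` for all `h ∈ H`. -/
def IsTwist (χ ψ : H →* Lˣ) (g : G) (s : L ≃ₐ[F] L) : Prop :=
  ∀ h : H, ∃ hh : g * h * g⁻¹ ∈ H, (ψ h : L) = s (χ ⟨g * h * g⁻¹, hh⟩)

/-- Moving `g` across the image of `charEmb` replaces `χ` by its conjugate and twists the
coefficient. -/
theorem charEmb_mul_of {χ ψ : H →* Lˣ} {g : G} {s : L ≃ₐ[F] L} (hg : IsTwist χ ψ g s) (a : L) :
    charEmb χ a * of F G g = of F G g * charEmb ψ (s a) := by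
  choose hH hs using hg
  simp only [charEmb_apply, Finset.mul_sum, Finset.sum_mul, of_apply, single_mul_single, one_mul,
    mul_one]
  have hinj : Function.Injective fun h : H => (⟨g * h * g⁻¹, hH h⟩ : H) := fun x y hxy => by
    simpa using congrArg Subtype.val hxy
  refine (Fintype.sum_equiv (Equiv.ofBijective _ (Finite.injective_iff_bijective.mp hinj))
    _ _ fun x => ?_).symm
  simp only [Equiv.ofBijective_apply]
  have : ((ψ x)⁻¹ : Lˣ).1 = s ((χ ⟨g * x * g⁻¹, hH x⟩)⁻¹ : Lˣ).1 := by
    rw [Units.val_inv_eq_inv_val, Units.val_inv_eq_inv_val, map_inv₀, hs]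
  rw [this, ← map_mul, Algebra.trace_eq_of_algEquiv]
  congr 1
  group

namespace IsTwist

omit [Fintype H]

theorem mul {χ : H →* Lˣ} {g g' : G} {s s' : L ≃ₐ[F] L} (hg : IsTwist χ χ g s)
    (hg' : IsTwist χ χ g' s') : IsTwist χ χ (g * g') (s.trans s') := fun h => by
  obtain ⟨h1, h2⟩ := hg' h
  obtain ⟨h3, h4⟩ := hg ⟨_, h1⟩
  have e : g * (g' * h * g'⁻¹) * g⁻¹ = g * g' * h * (g * g')⁻¹ := by group
  refine ⟨e ▸ h3, ?_⟩
  rw [h2, h4, AlgEquiv.trans_apply]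
  congr! 5

theorem of_mem (χ : H →* Lˣ) {g : G} (hg : g ∈ H) :
    IsTwist χ χ g (AlgEquiv.refl : L ≃ₐ[F] L) := fun h => by
  refine ⟨H.mul_mem (H.mul_mem hg h.2) (H.inv_mem hg), ?_⟩
  have : (⟨g * h * g⁻¹, H.mul_mem (H.mul_mem hg h.2) (H.inv_mem hg)⟩ : H) =
    ⟨g, hg⟩ * h * ⟨g, hg⟩⁻¹ := rfl
  rw [this, map_mul, map_mul, map_inv, mul_comm (χ _), mul_inv_cancel_right]
  rfl

/-- The twisting automorphism carries `χ(h)` to `χ(g⁻¹ h g)`. -/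
theorem apply_eq {χ : H →* Lˣ} {g : G} {s : L ≃ₐ[F] L} (hg : IsTwist χ χ g s) (h h' : H)
    (hh : (h' : G) = g⁻¹ * h * g) : s (χ h) = χ h' := by
  obtain ⟨h1, h2⟩ := hg h'
  rw [h2]
  congr! 3
  rw [Subtype.ext_iff]
  simp [hh, mul_assoc]

theorem unique [Finite H] {χ : H →* Lˣ} (hχ : ∀ s : L ≃ₐ[F] L, (∀ h, s (χ h) = χ h) → s = 1)
    {g : G} {s s' : L ≃ₐ[F] L} (hg : IsTwist χ χ g s) (hg' : IsTwist χ χ g s') : s = s' := by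
  have h1 : s.symm.trans s' = 1 := hχ _ fun h => by
    obtain ⟨h1, h2⟩ := hg h
    obtain ⟨h3, h4⟩ := hg' h
    conv_lhs => rw [h2]
    rw [AlgEquiv.trans_apply, AlgEquiv.symm_apply_apply, h4]
  ext a
  simpa using (DFunLike.congr_fun h1 (s a)).symm

end IsTwist

/-- The product of the images of two characters of `H`: the first factor acts on the second through
`ψ`, by the scalar computed in `sum_trace_mul_inv_mul`. -/
theorem charEmb_mul_charEmb_eq_charEmb_sum (χ ψ : H →* Lˣ) (a b : L) :
    charEmb χ a * charEmb ψ b = charEmb (F := F) ψ ((∑ h : H, ((Nat.card H : F)⁻¹ *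
      Algebra.trace F L (a * ((χ h)⁻¹ : Lˣ).1)) • (ψ h : L)) * b) := by
  rw [charEmb_apply χ, Finset.sum_mul, Finset.sum_mul, map_sum]
  refine Finset.sum_congr rfl fun h _ => ?_
  rw [smul_mul_assoc, map_smul, ← of_mul_charEmb, ← smul_mul_assoc]
  simp

variable [FiniteDimensional F L] [IsGalois F L]

/-- Orthogonality of the characters: the trace is the sum over the Galois group, and only the
automorphisms `s` with `s ∘ χ = ψ` contribute. -/
theorem sum_trace_mul_inv_mul [CharZero F] (χ ψ : H →* Lˣ) (a : L) [Fintype (L ≃ₐ[F] L)]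
    [DecidablePred fun s : L ≃ₐ[F] L => ∀ h, s (χ h) = ψ h] :
    ∑ h : H, ((Nat.card H : F)⁻¹ * Algebra.trace F L (a * ((χ h)⁻¹ : Lˣ).1)) • (ψ h : L) =
      ∑ s : L ≃ₐ[F] L, if ∀ h, s (χ h) = ψ h then s a else 0 := by
  classical
  have : CharZero L := charZero_of_injective_algebraMap (algebraMap F L).injective
  have h0 : (Nat.card H : L) ≠ 0 := Nat.cast_ne_zero.mpr Nat.card_pos.ne'
  simp only [Algebra.smul_def, map_mul, trace_eq_sum_automorphisms, map_inv₀, map_natCast,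
    Finset.mul_sum, Finset.sum_mul]
  rw [Finset.sum_comm]
  refine Finset.sum_congr (by congr!) fun s _ => ?_
  have key : ∀ h : H, (Nat.card H : L)⁻¹ * (s a * s ((χ h)⁻¹ : Lˣ).1) * (ψ h : L) =
      (Nat.card H : L)⁻¹ * s a *
        ((Units.coeHom L).comp (ψ * ((Units.map (s : L →* L)).comp χ)⁻¹)) h := fun h => by
    simp
    ring
  simp only [key, ← Finset.mul_sum]
  split_ifs with hs
  · have : (Units.coeHom L).comp (ψ * ((Units.map (s : L →* L)).comp χ)⁻¹) = 1 := by
      ext h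
      simp [hs h]
    simp [this]
    field_simp
  · rw [sum_hom_units_eq_zero _ ?_, mul_zero]
    intro h
    refine hs fun x => ?_
    have := DFunLike.congr_fun h x
    simp at this
    rw [mul_inv_eq_one₀ (by simp)] at this
    exact this.symm

/-- The idempotents of two characters which are not Galois conjugate are orthogonal. -/
theorem charEmb_mul_charEmb_eq_zero [CharZero F] (χ ψ : H →* Lˣ)
    (h : ∀ s : L ≃ₐ[F] L, ∃ h, s (χ h) ≠ ψ h) (a b : L) :
    charEmb χ a * charEmb (F := F) ψ b = 0 := by
  classical
  rw [charEmb_mul_charEmb_eq_charEmb_sum, sum_trace_mul_inv_mul, Finset.sum_eq_zero]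
  · simp
  · intro s _
    rw [if_neg (not_forall.mpr (h s))]

theorem sum_trace_mul_inv_mul_self [CharZero F] {χ : H →* Lˣ}
    (hχ : ∀ s : L ≃ₐ[F] L, (∀ h, s (χ h) = χ h) → s = 1) (a : L) :
    ∑ h : H, ((Nat.card H : F)⁻¹ * Algebra.trace F L (a * ((χ h)⁻¹ : Lˣ).1)) • (χ h : L) = a := by
  classical
  rw [sum_trace_mul_inv_mul, Finset.sum_eq_single 1]
  · simp
  · intro s _ hs
    rw [if_neg (mt (hχ s) hs)]
  · simp

/-- If no nontrivial automorphism of `L` fixes `χ`, that is, if its values generate `L`, then `charEmb χ` is multiplicative. -/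
theorem charEmb_mul [CharZero F] {χ : H →* Lˣ}
    (hχ : ∀ s : L ≃ₐ[F] L, (∀ h, s (χ h) = χ h) → s = 1) (a b : L) :
    charEmb (F := F) χ (a * b) = charEmb χ a * charEmb χ b := by
  rw [charEmb_mul_charEmb_eq_charEmb_sum, sum_trace_mul_inv_mul_self hχ]

end CharEmbedding

/-! ### Central idempotents of crossed products -/

namespace CrossedProduct

variable {F L Q : Type*} [Field F] [Field L] [Algebra F L] [Group Q] {S : CrossedSystem F L Q}

/-- The coefficient `a_q` of `∑ u_q a_q`. -/
noncomputable def coeff (q : Q) : CrossedProduct S →+ L := Finsupp.applyAddHom q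

theorem coeff_single_self (q : Q) (a : L) : coeff q (single S q a) = a :=
  Finsupp.single_eq_same

theorem coeff_single_of_ne {p q : Q} (h : p ≠ q) (a : L) : coeff q (single S p a) = 0 :=
  Finsupp.single_eq_of_ne h.symm

theorem ext_coeff {x y : CrossedProduct S} (h : ∀ q, coeff q x = coeff q y) : x = y :=
  Finsupp.ext h

theorem coeff_single_one_mul (q : Q) (a : L) (x : CrossedProduct S) :
    coeff q (single S 1 (((S.τ 1 1)⁻¹ : Lˣ) * a) * x) = S.σ q a * coeff q x := by
  induction x using CrossedProduct.induction with
  | h0 => simp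
  | ha x y hx hy => rw [mul_add, map_add, hx, hy, map_add, mul_add]
  | hs p b =>
    have h1 : S.τ 1 p * S.σ p (((S.τ 1 1)⁻¹ : Lˣ) * a) = S.σ p a := by
      rw [← σ_τ_one, ← map_mul, ← mul_assoc, Units.mul_inv, one_mul]
    rw [single_mul_single, one_mul, h1]
    rcases eq_or_ne p q with rfl | h
    · simp only [coeff_single_self]
    · simp only [coeff_single_of_ne h, mul_zero]

theorem coeff_mul_single_one (q : Q) (a : L) (x : CrossedProduct S) :
    coeff q (x * single S 1 (((S.τ 1 1)⁻¹ : Lˣ) * a)) = a * coeff q x := by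
  induction x using CrossedProduct.induction with
  | h0 => simp
  | ha x y hx hy => rw [add_mul, map_add, hx, hy, map_add, mul_add]
  | hs p b =>
    rw [single_mul_single, mul_one, σ_one, τ_one, mul_right_comm, ← mul_assoc, Units.mul_inv,
      one_mul]
    rcases eq_or_ne p q with rfl | h
    · simp only [coeff_single_self]
    · simp only [coeff_single_of_ne h, mul_zero]

/-- If `Q` acts faithfully on the field `L`, then the central elements of the crossed product lie
in `u_1 L`, so that `0` and `1` are the only central idempotents. -/
theorem eq_zero_or_one_of_isIdempotentElem (hS : ∀ q, (∀ a, S.σ q a = a) → q = 1)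
    {z : CrossedProduct S} (hz : IsIdempotentElem z) (hc : ∀ x, x * z = z * x) :
    z = 0 ∨ z = 1 := by
  have h1 : ∀ q, q ≠ 1 → coeff q z = 0 := fun q hq => by
    by_contra h
    refine hq (hS q fun a => ?_)
    have := congrArg (coeff q) (hc (single S 1 (((S.τ 1 1)⁻¹ : Lˣ) * a)))
    rw [coeff_single_one_mul, coeff_mul_single_one] at this
    exact mul_right_cancel₀ h this
  have h2 : z = single S 1 (((S.τ 1 1)⁻¹ : Lˣ) * (S.τ 1 1 * coeff 1 z)) := by
    rw [← mul_assoc, Units.inv_mul, one_mul]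
    refine ext_coeff fun q => ?_
    rcases eq_or_ne q 1 with rfl | h
    · rw [coeff_single_self]
    · rw [h1 q h, coeff_single_of_ne h.symm]
  have h3 : S.τ 1 1 * coeff 1 z * coeff 1 z = coeff 1 z := by
    have h4 := coeff_single_one_mul 1 (S.τ 1 1 * coeff 1 z) z
    rwa [← h2, hz.eq, σ_one, eq_comm] at h4
  rcases eq_or_ne (coeff 1 z) 0 with h | h
  · left
    rw [h2, h, mul_zero, mul_zero, map_zero]
  · right
    rw [h2, mul_right_cancel₀ h (h3.trans (one_mul _).symm), mul_one, one_def]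

end CrossedProduct

/-! ### Crossed products inside the group algebra -/

section CrossedEmbedding

open MonoidAlgebra

variable {F L G Q : Type*} [Field F] [Field L] [Algebra F L] [Group G] [Group Q]
  {H : Subgroup G} [Fintype H]

/-- The `F`-linear map `FG → L` which is `χ` on `H` and vanishes on `G \ H`. -/
noncomputable def charProj (χ : H →* Lˣ) : MonoidAlgebra F G →ₗ[F] L where
  toFun x := ∑ h : H, x.coeff (h : G) • (χ h : L)
  map_add' x y := by simp [add_smul, Finset.sum_add_distrib]
  map_smul' r x := by simp [Finset.smul_sum, mul_smul]

theorem charProj_single_coe (χ : H →* Lˣ) (h : H) (a : F) :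
    charProj χ (single (h : G) a) = a • (χ h : L) := by
  classical
  simp [charProj, Finsupp.single_apply]

theorem charProj_single_of_notMem (χ : H →* Lˣ) {g : G} (hg : g ∉ H) (a : F) :
    charProj χ (single g a) = (0 : L) := by
  classical
  refine Finset.sum_eq_zero fun h _ => ?_
  rw [coeff_single, Finsupp.single_apply, if_neg, zero_smul]
  rintro rfl
  exact hg h.2

theorem charProj_of_mul_charEmb_of_notMem (χ : H →* Lˣ) {g : G} (hg : g ∉ H) (a : L) :
    charProj χ (of F G g * charEmb χ a) = 0 := by
  simp only [charEmb_apply, Finset.mul_sum, of_apply, single_mul_single, map_sum]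
  refine Finset.sum_eq_zero fun h _ => charProj_single_of_notMem χ ?_ _
  rwa [Subgroup.mul_mem_cancel_right _ h.2]

/-- The `F`-linear map from a crossed product to `FG` which sends `u_q a` to `r(q) a`, where
`a ∈ L` is viewed in `FG` by means of `charEmb χ`. -/
noncomputable def crossedEmb (S : CrossedSystem F L Q) (χ : H →* Lˣ) (r : Q → G) :
    CrossedProduct S →ₗ[F] MonoidAlgebra F G :=
  (Finsupp.lsum F fun q => (LinearMap.mulLeft F (of F G (r q))).comp (charEmb χ) :
    (Q →₀ L) →ₗ[F] MonoidAlgebra F G)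

theorem crossedEmb_single (S : CrossedSystem F L Q) (χ : H →* Lˣ) (r : Q → G) (q : Q) (a : L) :
    crossedEmb S χ r (CrossedProduct.single S q a) = of F G (r q) * charEmb χ a :=
  Finsupp.lsum_single F (fun q => (LinearMap.mulLeft F (of F G (r q))).comp (charEmb χ)) q a

variable [FiniteDimensional F L] [IsGalois F L] [CharZero F] {S : CrossedSystem F L Q}
  {χ : H →* Lˣ} {r : Q → G}

/-- If `σ_q` is the twist of `χ` by `r(q)` and `τ(p,q) = χ(r(pq)⁻¹ r(p) r(q))`, then `crossedEmb` is
multiplicative. -/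
theorem crossedEmb_mul (hχ : ∀ s : L ≃ₐ[F] L, (∀ h, s (χ h) = χ h) → s = 1)
    (hσ : ∀ q, IsTwist χ χ (r q) (S.σ q))
    (hτ : ∀ p q, ∃ h : H, r p * r q = r (p * q) * h ∧ (S.τ p q : L) = χ h)
    (x y : CrossedProduct S) :
    crossedEmb S χ r (x * y) = crossedEmb S χ r x * crossedEmb S χ r y := by
  induction x using CrossedProduct.induction with
  | h0 => simp
  | ha x x' hx hx' => simp only [add_mul, map_add, hx, hx']
  | hs p a =>
  induction y using CrossedProduct.induction with
  | h0 => simp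
  | ha y y' hy hy' => simp only [mul_add, map_add, hy, hy']
  | hs q b =>
    obtain ⟨h, h1, h2⟩ := hτ p q
    rw [CrossedProduct.single_mul_single]
    simp only [crossedEmb_single]
    calc of F G (r (p * q)) * charEmb χ (S.τ p q * S.σ q a * b)
        = of F G (r (p * q)) * of F G h * charEmb χ (S.σ q a * b) := by
          rw [mul_assoc _ (of F G h), of_mul_charEmb, h2, mul_assoc]
      _ = of F G (r p) * (of F G (r q) * charEmb χ (S.σ q a)) * charEmb χ b := by
          rw [← map_mul, ← h1, map_mul, charEmb_mul hχ]; simp only [mul_assoc]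
      _ = of F G (r p) * charEmb χ a * (of F G (r q) * charEmb χ b) := by
          rw [← charEmb_mul_of (hσ q)]; simp only [mul_assoc]

omit [FiniteDimensional F L] [IsGalois F L] [CharZero F] in
theorem crossedEmb_one
    (hτ : ∀ p q, ∃ h : H, r p * r q = r (p * q) * h ∧ (S.τ p q : L) = χ h) :
    crossedEmb S χ r 1 = charEmb χ 1 := by
  obtain ⟨h, h1, h2⟩ := hτ 1 1
  rw [one_mul] at h1
  rw [CrossedProduct.one_def, crossedEmb_single, mul_left_cancel h1, of_mul_charEmb, ← h2,
    Units.mul_inv]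

theorem charProj_charEmb (hχ : ∀ s : L ≃ₐ[F] L, (∀ h, s (χ h) = χ h) → s = 1) (a : L) :
    charProj χ (charEmb (F := F) χ a) = a := by
  simp only [charEmb_apply, map_sum, charProj_single_coe]
  exact sum_trace_mul_inv_mul_self hχ a

/-- The coefficients of an element of the crossed product are recovered from its image. -/
theorem charProj_of_inv_mul_crossedEmb (hχ : ∀ s : L ≃ₐ[F] L, (∀ h, s (χ h) = χ h) → s = 1)
    (hr : ∀ p q, (r q)⁻¹ * r p ∈ H → p = q) (q : Q) (x : CrossedProduct S) :
    charProj χ (of F G (r q)⁻¹ * crossedEmb S χ r x) = CrossedProduct.coeff q x := by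
  induction x using CrossedProduct.induction with
  | h0 => simp
  | ha x x' hx hx' => simp only [mul_add, map_add, hx, hx']
  | hs p a =>
    rw [crossedEmb_single, ← mul_assoc, ← map_mul]
    rcases eq_or_ne p q with rfl | h
    · rw [inv_mul_cancel, map_one, one_mul, charProj_charEmb hχ, CrossedProduct.coeff_single_self]
    · rw [CrossedProduct.coeff_single_of_ne h]
      exact charProj_of_mul_charEmb_of_notMem χ (mt (hr p q) h) a

theorem crossedEmb_injective (hχ : ∀ s : L ≃ₐ[F] L, (∀ h, s (χ h) = χ h) → s = 1)
    (hr : ∀ p q, (r q)⁻¹ * r p ∈ H → p = q) : Function.Injective (crossedEmb S χ r) :=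
  fun x y h => CrossedProduct.ext_coeff fun q => by
    rw [← charProj_of_inv_mul_crossedEmb hχ hr, h, charProj_of_inv_mul_crossedEmb hχ hr]

/-- For `H` normal, an element `g` which does not stabilize the Galois class of `χ` contributes
nothing to the corner of the idempotent of `χ`. -/
theorem charEmb_mul_of_mul_charEmb_eq_zero [H.Normal] {g : G}
    (hg : ∀ s : L ≃ₐ[F] L, ¬ IsTwist χ χ g s) (a b : L) :
    charEmb χ a * of F G g * charEmb χ b = 0 := by
  have h1 : IsTwist χ (χ.comp (MulAut.conjNormal g).toMonoidHom) g (AlgEquiv.refl : L ≃ₐ[F] L) :=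
    fun h => ⟨Subgroup.Normal.conj_mem ‹_› _ h.2 _, rfl⟩
  rw [charEmb_mul_of h1, mul_assoc, charEmb_mul_charEmb_eq_zero, mul_zero]
  intro s
  by_contra! h
  exact hg s fun x => ⟨Subgroup.Normal.conj_mem ‹_› _ x.2 _, (h x).symm⟩

/-- The crossed product maps onto the corner of `charEmb χ 1`, if every element which stabilizes the
Galois class of `χ` lies in some coset `r(q) H`. -/
theorem exists_crossedEmb_eq (hχ : ∀ s : L ≃ₐ[F] L, (∀ h, s (χ h) = χ h) → s = 1) [H.Normal]
    (hr : ∀ g (s : L ≃ₐ[F] L), IsTwist χ χ g s → ∃ q, ∃ h : H, g = r q * h)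
    (x : MonoidAlgebra F G) :
    ∃ z, crossedEmb S χ r z = charEmb χ 1 * x * charEmb χ 1 := by
  induction x using MonoidAlgebra.induction_linear with
  | zero => exact ⟨0, by simp⟩
  | add x y hx hy =>
    obtain ⟨z, hz⟩ := hx
    obtain ⟨w, hw⟩ := hy
    exact ⟨z + w, by rw [map_add, hz, hw, mul_add, add_mul]⟩
  | single g c =>
    have hc : single g c = c • of F G g := by simp
    by_cases h : ∃ s : L ≃ₐ[F] L, IsTwist χ χ g s
    · obtain ⟨s, hs⟩ := h
      obtain ⟨q, h, hq⟩ := hr g s hs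
      refine ⟨c • CrossedProduct.single S q (χ h), ?_⟩
      rw [map_smul, crossedEmb_single, hc, mul_smul_comm, smul_mul_assoc, charEmb_mul_of hs,
        map_one, mul_assoc, ← charEmb_mul hχ, mul_one, hq, map_mul, mul_assoc, of_mul_charEmb,
        mul_one]
    · refine ⟨0, ?_⟩
      rw [hc, mul_smul_comm, smul_mul_assoc,
        charEmb_mul_of_mul_charEmb_eq_zero (not_exists.mp h), smul_zero, map_zero]

end CrossedEmbedding

/-! ### The crossed system attached to a section -/

section CrossedSystemOfSection

variable {F L G : Type*} [Field F] [Field L] [Algebra F L] [Group G] {H E : Subgroup G}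

/-- If all the elements of `E` twist `χ`, then every choice of representatives of `E/H` in `E`
yields a crossed system: `σ_q` is the twist of the representative of `q`, and `τ` is the value of
`χ` at the cocycle of the representatives. -/
theorem exists_crossedSystem [Finite H] [(H.subgroupOf E).Normal] {χ : H →* Lˣ}
    (hχ : ∀ s : L ≃ₐ[F] L, (∀ h, s (χ h) = χ h) → s = 1)
    (hE : ∀ g : E, ∃ s : L ≃ₐ[F] L, IsTwist χ χ (g : G) s)
    (r : E ⧸ H.subgroupOf E → E) (hr : ∀ q, (r q : E ⧸ H.subgroupOf E) = q) :
    ∃ S : CrossedSystem F L (E ⧸ H.subgroupOf E),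
      (∀ q, IsTwist χ χ (r q : G) (S.σ q)) ∧
      ∀ p q, ∃ h : H, (r p * r q : G) = r (p * q) * h ∧ (S.τ p q : L) = χ h := by
  choose s hs using hE
  have hmem : ∀ p q, (r (p * q) : G)⁻¹ * ((r p : G) * r q) ∈ H := fun p q => by
    have : ((r (p * q) : E) : E ⧸ H.subgroupOf E) = (r p * r q : E) := by
      rw [QuotientGroup.mk_mul, hr, hr, hr]
    exact Subgroup.mem_subgroupOf.mp (QuotientGroup.eq.mp this)
  refine ⟨⟨fun q => s (r q), fun p q => χ ⟨_, hmem p q⟩, fun p q a => ?_, fun p q t => ?_⟩,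
    fun q => hs _, fun p q => ⟨⟨_, hmem p q⟩, by simp, rfl⟩⟩
  · have h1 := (hs (r (p * q))).mul (IsTwist.of_mem (F := F) χ (hmem p q))
    rw [mul_inv_cancel_left] at h1
    exact DFunLike.congr_fun (h1.unique hχ ((hs (r p)).mul (hs (r q)))) a
  · have h1 : (r t : G)⁻¹ * ((r (p * q) : G)⁻¹ * ((r p : G) * r q)) * r t ∈ H := by
      have h2 := mul_mem (mul_mem (inv_mem (hmem (p * q) t)) (hmem p (q * t))) (hmem q t)
      rw [← mul_assoc p] at h2
      convert h2 using 1
      group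
    rw [(hs (r t)).apply_eq ⟨_, hmem p q⟩ ⟨_, h1⟩ rfl, ← Units.val_mul, ← Units.val_mul, ← map_mul,
      ← map_mul]
    congr! 2
    rw [Subtype.ext_iff]
    simp only [Subgroup.coe_mul, mul_assoc]
    group

end CrossedSystemOfSection

/-! ### The idempotents of a Galois class of characters -/

section FaithfulCharacters

open MonoidAlgebra

variable {F : Type*} [Field F] {G : Type*} [Group G] {H K : Subgroup G}

theorem FaithfulChar.exists_isPrimitiveRoot [Finite G] (χ : FaithfulChar F H K)
    [(K.subgroupOf H).Normal] [IsCyclic (H ⧸ K.subgroupOf H)] :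
    ∃ h : H, IsPrimitiveRoot (χ.1 h : CycField F H K) (K.relIndex H) := by
  obtain ⟨y, hy⟩ := IsCyclic.exists_generator (α := H ⧸ K.subgroupOf H)
  obtain ⟨y, rfl⟩ := QuotientGroup.mk_surjective y
  have h1 : χ.1.range = Subgroup.zpowers (χ.1 y) := by
    refine le_antisymm ?_ (by simp [Subgroup.zpowers_le])
    rintro _ ⟨h, rfl⟩
    obtain ⟨i, hi⟩ := hy h
    have h2 : ((y ^ i : H) : H ⧸ K.subgroupOf H) = h := hi
    rw [QuotientGroup.eq, ← χ.2, MonoidHom.mem_ker, map_mul, map_inv, inv_mul_eq_one] at h2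
    rw [← h2, map_zpow]
    exact ⟨i, rfl⟩
  refine ⟨y, IsPrimitiveRoot.coe_units_iff.mpr ?_⟩
  have h2 : orderOf (χ.1 y) = K.relIndex H := by
    rw [← Nat.card_zpowers, ← h1, ← Subgroup.index_ker, χ.2]
    rfl
  exact IsPrimitiveRoot.iff_orderOf.mpr h2

instance CycField.neZero_relIndex [Finite G] [CharZero F] : NeZero ((K.relIndex H : ℕ) : F) :=
  ⟨Nat.cast_ne_zero.mpr (Subgroup.index_ne_zero_of_finite : (K.subgroupOf H).index ≠ 0)⟩

instance CycField.finiteDimensional [Finite G] [CharZero F] :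
    FiniteDimensional F (CycField F H K) :=
  IsCyclotomicExtension.finiteDimensional {K.relIndex H} F (CycField F H K)

instance CycField.isGalois [Finite G] [CharZero F] : IsGalois F (CycField F H K) :=
  IsCyclotomicExtension.isGalois {K.relIndex H} F (CycField F H K)

/-- The values of a faithful character of the cyclic group `H/K` generate `F(ζ_k)`, so that only the
identity fixes all of them. -/
theorem FaithfulChar.eq_one_of_forall_apply_eq [Finite G] [CharZero F] (χ : FaithfulChar F H K)
    [(K.subgroupOf H).Normal] [IsCyclic (H ⧸ K.subgroupOf H)]
    (s : CycField F H K ≃ₐ[F] CycField F H K)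
    (hs : ∀ h, s (χ.1 h : CycField F H K) = χ.1 h) : s = 1 := by
  obtain ⟨h, hh⟩ := χ.exists_isPrimitiveRoot
  refine IsCyclotomicExtension.algEquiv_eq_of_apply_eq (A := F) (B := CycField F H K) (S := {K.relIndex H}) ?_
  rintro _ rfl -
  exact ⟨_, hh, hs h⟩

/-- The idempotent `ε_C` is the image of `1`; the sums differ by the substitution `h ↦ h⁻¹`. -/
theorem epsChar_eq_charEmb_one [Fintype H] (χ : FaithfulChar F H K) :
    epsChar χ = charEmb χ.1 1 := by
  rw [epsChar, finsum_eq_sum_of_fintype, charEmb_apply]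
  exact Fintype.sum_equiv (Equiv.inv H) _ _ fun h => by simp

/-- For `H` normal, an element which twists `χ` by a Galois automorphism automatically normalizes the
kernel `K`. -/
theorem mem_stabE_iff [H.Normal] (χ : FaithfulChar F H K) (hK : K ≤ H) {g : G} :
    g ∈ stabE (charClass χ) ↔
      ∃ s : CycField F H K ≃ₐ[F] CycField F H K, IsTwist χ.1 χ.1 g s := by
  constructor
  · rintro ⟨hg, h⟩
    obtain ⟨s, hs⟩ := Quotient.exact h
    exact ⟨s, fun h => ⟨_, hs h⟩⟩
  · rintro ⟨s, hs⟩
    have hn : g ∈ Subgroup.normalizer (K : Set G) := by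
      have h1 : ∀ h : H, (h : G) ∈ K ↔ g * h * g⁻¹ ∈ K := fun h => by
        obtain ⟨h1, h2⟩ := hs h
        have h3 : χ.1 h = 1 ↔ χ.1 ⟨_, h1⟩ = 1 := by
          rw [← Units.val_eq_one, h2, map_eq_one_iff _ s.injective, Units.val_eq_one]
        rwa [← MonoidHom.mem_ker, ← MonoidHom.mem_ker, χ.2, Subgroup.mem_subgroupOf,
          Subgroup.mem_subgroupOf] at h3
      rw [Subgroup.mem_normalizer_iff]
      refine fun x => ⟨fun hx => (h1 ⟨x, hK hx⟩).mp hx, fun hx => ?_⟩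
      have hxH : x ∈ H := by
        have := Subgroup.Normal.conj_mem ‹H.Normal› _ (hK hx) g⁻¹
        simpa [mul_assoc] using this
      exact (h1 ⟨x, hxH⟩).mpr hx
    refine ⟨⟨by rw [Subgroup.normalizer_eq_top]; trivial, hn⟩, Quotient.sound ⟨s, fun h => ?_⟩⟩
    obtain ⟨h1, h2⟩ := hs h
    exact h2

theorem epsClass_charClass (χ : FaithfulChar F H K) : epsClass (charClass χ) = epsChar χ := rfl

theorem eClass_mem_center [Finite G] (C : CharClass F H K) :
    eClass C ∈ Set.center (MonoidAlgebra F G) := by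
  have key : ∀ x : G, of F G x * eClass C = eClass C * of F G x := fun x => by
    let f : MonoidAlgebra F G →+ MonoidAlgebra F G :=
      (AddMonoidHom.mulRight (of F G x)).comp (AddMonoidHom.mulLeft (of F G x⁻¹))
    have hf : ∀ y, f y = of F G x⁻¹ * y * of F G x := fun _ => rfl
    have hinj : Function.Injective f := fun y z h => by
      have h' := congrArg (fun y => of F G x * y * of F G x⁻¹) h
      simp only [hf, ← mul_assoc, ← map_mul, mul_inv_cancel, map_one, one_mul] at h'
      simpa only [mul_assoc, ← map_mul, mul_inv_cancel, map_one, mul_one] using h'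
    have h1 : Set.range (f ∘ fun g : G => single g⁻¹ (1 : F) * epsClass C * single g (1 : F)) =
        Set.range fun g : G => single g⁻¹ (1 : F) * epsClass C * single g (1 : F) := by
      rw [← (Equiv.mulRight x).surjective.range_comp (fun g : G =>
        single g⁻¹ (1 : F) * epsClass C * single g (1 : F))]
      congr 1
      funext g
      have h2 : single (g * x) (1 : F) = single g (1 : F) * single x 1 := by simp
      have h3 : single (g * x)⁻¹ (1 : F) = single x⁻¹ (1 : F) * single g⁻¹ 1 := by simp
      simp only [Function.comp, hf, Equiv.coe_mulRight, h2, h3, of_apply, mul_assoc]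
    have h1 : f (eClass C) = eClass C := by
      rw [eClass, f.map_finsum_mem _ (Set.finite_range _),
        ← finsum_mem_image (f := fun y => y) hinj.injOn, ← Set.range_comp, h1]
    rw [hf] at h1
    conv_lhs => rw [← h1]
    simp only [← mul_assoc, ← map_mul, mul_inv_cancel, map_one, one_mul]
  rw [Semigroup.mem_center_iff]
  intro y
  induction y using MonoidAlgebra.induction_linear with
  | zero => simp
  | add y z hy hz => rw [add_mul, mul_add, hy, hz]
  | single g c =>
    have hc : single g c = c • of F G g := by simp
    rw [hc, smul_mul_assoc, mul_smul_comm, key]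

end FaithfulCharacters

/-! ### Orthogonal conjugates and primitivity -/

section ConjugateIdempotents

open MonoidAlgebra
open scoped commutatorElement

variable {F : Type*} [Field F] {G : Type*} [Group G] {H K : Subgroup G}

/-- The idempotents `g ε g⁻¹`, for `g` in a set of representatives of `G/E`, are orthogonal. -/
theorem charEmb_matrixUnits [Finite G] [Fintype H] [CharZero F] [H.Normal]
    {χ : FaithfulChar F H K} (hK : K ≤ H)
    (hχ : ∀ s : CycField F H K ≃ₐ[F] CycField F H K,
      (∀ h, s (χ.1 h : CycField F H K) = χ.1 h) → s = 1)
    {ι : Type*} [DecidableEq ι] {g : ι → G}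
    (hg : ∀ i j, (g i)⁻¹ * g j ∈ stabE (charClass χ) → i = j) (i j : ι) :
    charEmb χ.1 1 * of F G (g i)⁻¹ * (of F G (g j) * charEmb χ.1 1) =
      if i = j then charEmb χ.1 1 else 0 := by
  have h1 : charEmb χ.1 1 * of F G (g i)⁻¹ * (of F G (g j) * charEmb χ.1 1) =
      charEmb χ.1 1 * of F G ((g i)⁻¹ * g j) * charEmb χ.1 1 := by
    rw [map_mul]; simp only [mul_assoc]
  rw [h1]
  split_ifs with h
  · rw [h, inv_mul_cancel, map_one (of F G), mul_one, ← charEmb_mul hχ, mul_one]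
  · refine charEmb_mul_of_mul_charEmb_eq_zero (fun s hs => h (hg i j ?_)) _ _
    exact (mem_stabE_iff χ hK).mpr ⟨s, hs⟩

theorem charEmb_one_ne_zero [Finite G] [Fintype H] [CharZero F] {χ : FaithfulChar F H K}
    (hχ : ∀ s : CycField F H K ≃ₐ[F] CycField F H K,
      (∀ h, s (χ.1 h : CycField F H K) = χ.1 h) → s = 1) :
    charEmb (F := F) χ.1 1 ≠ 0 := fun h => by
  simpa [h] using charProj_charEmb hχ 1

/-- `e_C` as a sum over representatives `g` of the left cosets of `E`: the conjugates `g ε g⁻¹`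
are the different conjugates of `ε`. -/
theorem eClass_eq_sum [Finite G] [Fintype H] [CharZero F] [H.Normal]
    {χ : FaithfulChar F H K} (hK : K ≤ H)
    (hχ : ∀ s : CycField F H K ≃ₐ[F] CycField F H K,
      (∀ h, s (χ.1 h : CycField F H K) = χ.1 h) → s = 1)
    {ι : Type*} [Fintype ι] {g : ι → G}
    (hg : ∀ i j, (g i)⁻¹ * g j ∈ stabE (charClass χ) → i = j)
    (hg' : ∀ x, ∃ i, (g i)⁻¹ * x ∈ stabE (charClass χ)) :
    eClass (charClass χ) =
      ∑ i, of F G (g i) * charEmb χ.1 1 * (charEmb χ.1 1 * of F G (g i)⁻¹) := by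
  classical
  have hid : charEmb χ.1 1 * charEmb χ.1 1 = charEmb (F := F) χ.1 1 := by
    rw [← charEmb_mul hχ, mul_one]
  have hunits := charEmb_matrixUnits hK hχ hg
  have hinj : Function.Injective fun i =>
      of F G (g i) * charEmb χ.1 1 * (charEmb χ.1 1 * of F G (g i)⁻¹) := fun i j h => by
    by_contra hij
    have h1 := congrArg (fun x => charEmb χ.1 1 * of F G (g i)⁻¹ * x * of F G (g i)) h
    simp only [← mul_assoc] at h1 hunits
    rw [hunits, hunits, if_pos rfl, if_neg hij, zero_mul, zero_mul, zero_mul, hid, mul_assoc,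
      ← map_mul, inv_mul_cancel, map_one (of F G), mul_one] at h1
    exact charEmb_one_ne_zero hχ h1
  rw [← finsum_eq_sum_of_fintype, eClass, ← finsum_mem_range (f := fun y => y) hinj]
  congr! 4
  rw [epsClass_charClass, epsChar_eq_charEmb_one]
  ext y
  constructor
  · rintro ⟨x, rfl⟩
    obtain ⟨i, hi⟩ := hg' x⁻¹
    obtain ⟨s, hs⟩ := (mem_stabE_iff χ hK).mp hi
    refine ⟨i, ?_⟩
    have h1 := charEmb_mul_of hs 1
    rw [map_one s, map_mul, ← mul_assoc] at h1
    simp only [← of_apply]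
    have h2 : of F G x⁻¹ * of F G x = 1 := by rw [← map_mul, inv_mul_cancel, map_one]
    have h3 : of F G (g i) * of F G (g i)⁻¹ = 1 := by rw [← map_mul, mul_inv_cancel, map_one]
    calc of F G (g i) * charEmb χ.1 1 * (charEmb χ.1 1 * of F G (g i)⁻¹)
        = of F G (g i) * (charEmb χ.1 1 * charEmb χ.1 1) * of F G (g i)⁻¹ * 1 := by
          simp only [mul_assoc, mul_one]
      _ = of F G (g i) * (charEmb χ.1 1 * of F G (g i)⁻¹ * of F G x⁻¹) * of F G x := by
          rw [hid, ← h2]; simp only [mul_assoc]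
      _ = (of F G (g i) * of F G (g i)⁻¹) * of F G x⁻¹ * charEmb χ.1 1 * of F G x := by
          rw [h1]; simp only [mul_assoc]
      _ = of F G x⁻¹ * charEmb χ.1 1 * of F G x := by rw [h3, one_mul]
  · rintro ⟨i, rfl⟩
    refine ⟨(g i)⁻¹, ?_⟩
    simp only [← of_apply, inv_inv, mul_assoc]
    rw [← mul_assoc (charEmb χ.1 1) (charEmb χ.1 1), hid]

/-- Representatives of the left cosets of a subgroup of finite index, indexed by `Fin`. -/
theorem exists_leftCoset_representatives [Finite G] (E : Subgroup G) :
    ∃ g : Fin E.index → G, (∀ i j, (g i)⁻¹ * g j ∈ E → i = j) ∧ ∀ x, ∃ i, (g i)⁻¹ * x ∈ E := by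
  let f : Fin E.index ≃ G ⧸ E := (Finite.equivFinOfCardEq rfl).symm
  refine ⟨fun i => (f i).out, fun i j h => ?_, fun x => ⟨f.symm x, ?_⟩⟩
  · rw [← QuotientGroup.eq, QuotientGroup.out_eq', QuotientGroup.out_eq'] at h
    exact f.injective h
  · rw [← QuotientGroup.eq, QuotientGroup.out_eq', f.apply_symm_apply]

/-- `ε_C` is one of the orthogonal summands of `e_C`. -/
theorem charEmb_one_mul_eClass [Finite G] [Fintype H] [CharZero F] [H.Normal]
    {χ : FaithfulChar F H K} (hK : K ≤ H)
    (hχ : ∀ s : CycField F H K ≃ₐ[F] CycField F H K,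
      (∀ h, s (χ.1 h : CycField F H K) = χ.1 h) → s = 1) :
    charEmb χ.1 1 * eClass (charClass χ) = charEmb χ.1 1 := by
  classical
  obtain ⟨g, hg, hg'⟩ := exists_leftCoset_representatives (stabE (charClass χ))
  have hsum := eClass_eq_sum hK hχ hg hg'
  have hunits := charEmb_matrixUnits hK hχ hg
  have hid : charEmb χ.1 1 * charEmb χ.1 1 = charEmb (F := F) χ.1 1 := by
    rw [← charEmb_mul hχ, mul_one]
  obtain ⟨i, hi⟩ := hg' 1
  have hε : charEmb χ.1 1 * of F G (g i)⁻¹ * eClass (charClass χ) =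
      charEmb χ.1 1 * of F G (g i)⁻¹ := by
    rw [hsum, Finset.mul_sum, Finset.sum_eq_single i]
    · rw [← mul_assoc, hunits, if_pos rfl, ← mul_assoc, hid]
    · intro j _ hj
      rw [← mul_assoc, hunits, if_neg hj.symm, zero_mul]
    · simp
  have h1 := congrArg (· * of F G (g i)) hε
  rwa [mul_assoc _ (eClass _), ← Semigroup.mem_center_iff.mp (eClass_mem_center (charClass χ)) (of F G (g i)), ← mul_assoc,
    mul_assoc _ (of F G (g i)⁻¹), ← map_mul, inv_mul_cancel, map_one (of F G), mul_one] at h1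

/-- The corner of `ε_C` is the crossed product of `F(ζ_k)` by `E/H`. -/
theorem crossedEmb_stabE [Finite G] [Fintype H] [CharZero F] [H.Normal]
    {χ : FaithfulChar F H K} (hK : K ≤ H)
    (hχ : ∀ s : CycField F H K ≃ₐ[F] CycField F H K,
      (∀ h, s (χ.1 h : CycField F H K) = χ.1 h) → s = 1)
    {r : QuotEH (charClass χ) → stabE (charClass χ)}
    (hr : ∀ q, (r q : QuotEH (charClass χ)) = q)
    {S : CrossedSystem F (CycField F H K) (QuotEH (charClass χ))} :
    Function.Injective (crossedEmb S χ.1 fun q => (r q : G)) ∧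
      ∀ x, ∃ z, crossedEmb S χ.1 (fun q => (r q : G)) z = charEmb χ.1 1 * x * charEmb χ.1 1 := by
  refine ⟨crossedEmb_injective hχ fun p q h => ?_, exists_crossedEmb_eq hχ fun g s hs => ?_⟩
  · rw [← hr p, ← hr q, eq_comm, QuotientGroup.eq]
    exact h
  · let g' : stabE (charClass χ) := ⟨g, (mem_stabE_iff χ hK).mpr ⟨s, hs⟩⟩
    have h1 : (r (g' : QuotEH (charClass χ)) : QuotEH (charClass χ)) = g' := hr _
    rw [QuotientGroup.eq] at h1
    exact ⟨g', ⟨_, h1⟩, by simp [g']⟩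

/-- If only the elements of `H` stabilize `χ` itself, then `e_C` is primitive: a central
idempotent below `e_C` is determined by its component in the corner of `ε_C`, where it is a central
idempotent of a crossed product with faithful action. -/
theorem isPrimitiveCentralIdempotent_eClass [Finite G] [CharZero F] [H.Normal]
    {χ : FaithfulChar F H K} (hK : K ≤ H)
    (hχ : ∀ s : CycField F H K ≃ₐ[F] CycField F H K,
      (∀ h, s (χ.1 h : CycField F H K) = χ.1 h) → s = 1)
    (hf : ∀ g, IsTwist χ.1 χ.1 g (AlgEquiv.refl : CycField F H K ≃ₐ[F] CycField F H K) → g ∈ H) :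
    IsPrimitiveCentralIdempotent (eClass (charClass χ)) := by
  classical
  have := Fintype.ofFinite H
  obtain ⟨g, hg, hg'⟩ := exists_leftCoset_representatives (stabE (charClass χ))
  have hsum := eClass_eq_sum hK hχ hg hg'
  have hunits := charEmb_matrixUnits hK hχ hg
  have hid : charEmb χ.1 1 * charEmb χ.1 1 = charEmb (F := F) χ.1 1 := by
    rw [← charEmb_mul hχ, mul_one]
  have hidem : IsIdempotentElem (eClass (charClass χ)) := by
    rw [hsum]
    exact isIdempotentElem_sum_matrixUnits hunits fun i => by rw [← mul_assoc, hid]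
  have hce := eClass_mem_center (charClass χ)
  -- a central element which annihilates `ε_C` annihilates `e_C`
  have hann : ∀ f ∈ Set.center (MonoidAlgebra F G), f * charEmb χ.1 1 = 0 →
      f * eClass (charClass χ) = 0 := fun f hf h => by
    rw [hsum, Finset.mul_sum]
    refine Finset.sum_eq_zero fun j _ => ?_
    rw [← mul_assoc, ← mul_assoc, ← mul_assoc, ← Semigroup.mem_center_iff.mp hf (of F G (g j)),
      mul_assoc (of F G (g j)), h, mul_zero, zero_mul, zero_mul]
  refine ⟨hidem, hce, fun h0 => ?_, fun f f' hfi hfc hfi' hfc' hff hadd => ?_⟩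
  · refine charEmb_one_ne_zero hχ (F := F) ?_
    rw [← charEmb_one_mul_eClass hK hχ, h0, mul_zero]
  · have hfe : f * eClass (charClass χ) = f := by rw [← hadd, mul_add, hfi.eq, hff, add_zero]
    have hfe' : f' * eClass (charClass χ) = f' := by
      rw [← hadd, mul_add, hfi'.eq, Semigroup.mem_center_iff.mp hfc, hff, zero_add]
    let r : QuotEH (charClass χ) → stabE (charClass χ) := Quotient.out
    have hr : ∀ q, (r q : QuotEH (charClass χ)) = q := QuotientGroup.out_eq'
    obtain ⟨S, hσ, hτ⟩ := exists_crossedSystem hχ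
      (fun g => (mem_stabE_iff χ hK).mp g.2) r hr
    obtain ⟨hinj, hsurj⟩ := crossedEmb_stabE hK hχ hr (S := S)
    have hmul := crossedEmb_mul hχ hσ hτ
    have hone := crossedEmb_one hτ (F := F)
    set Θ := crossedEmb S χ.1 fun q => (r q : G)
    obtain ⟨z, hz⟩ := hsurj f
    have hcomm := Semigroup.mem_center_iff.mp hfc
    have hz1 : Θ z = f * charEmb χ.1 1 := by rw [hz, hcomm, mul_assoc, hid]
    have hl : ∀ w, charEmb χ.1 1 * Θ w = Θ w := fun w => by rw [← hone, ← hmul, one_mul]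
    have hr' : ∀ w, Θ w * charEmb χ.1 1 = Θ w := fun w => by rw [← hone, ← hmul, mul_one]
    have hzw : ∀ w, Θ z * Θ w = f * Θ w := fun w => by rw [hz1, mul_assoc, hl]
    have hwz : ∀ w, Θ w * Θ z = f * Θ w := fun w => by
      rw [hz1, ← mul_assoc, hcomm, mul_assoc, hr']
    have hzc : ∀ w, w * z = z * w := fun w => hinj <| by rw [hmul, hmul, hzw, hwz]
    have hzi : IsIdempotentElem z := hinj <| by
      rw [hmul, hzw, hz1, ← mul_assoc, hfi.eq]
    have hS : ∀ q, (∀ a, S.σ q a = a) → q = 1 := fun q hq => by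
      have h1 : S.σ q = AlgEquiv.refl := AlgEquiv.ext hq
      have h2 := hf (r q) (h1 ▸ hσ q)
      rw [← hr q, QuotientGroup.eq_one_iff]
      exact h2
    rcases CrossedProduct.eq_zero_or_one_of_isIdempotentElem hS hzi hzc with h | h
    · left
      rw [← hfe]
      refine hann f hfc ?_
      rw [← hz1, h, map_zero]
    · right
      rw [← hfe']
      refine hann f' hfc' ?_
      have h1 : f * charEmb χ.1 1 = charEmb χ.1 1 := by rw [← hz1, h, hone]
      rw [← h1, ← mul_assoc, hcomm, hff, zero_mul]

/-- The maximality of `H` makes `χ` a character whose only stabilizers are the elements of `H`. -/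
theorem mem_of_isTwist_refl [Finite G] [H.Normal] {A : Subgroup G}
    (hP : Maximal (fun B : Subgroup G => A ≤ B ∧ ⁅B, B⁆ ≤ K ∧ K ≤ B) H) (χ : FaithfulChar F H K)
    {g : G} (hg : IsTwist χ.1 χ.1 g (AlgEquiv.refl : CycField F H K ≃ₐ[F] CycField F H K)) :
    g ∈ H := by
  obtain ⟨hA, hH, hK⟩ := hP.prop
  have hgK : g ∈ Subgroup.normalizer (K : Set G) :=
    (stabE_le _ ((mem_stabE_iff χ hK).mpr ⟨_, hg⟩)).2
  have hHK : H ≤ Subgroup.normalizer (K : Set G) :=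
    (le_stabE hK hH (charClass χ)).trans ((stabE_le _).trans inf_le_right)
  have hcomm : ∀ h ∈ H, ⁅g, h⁆ ∈ K := fun h hh => by
    obtain ⟨h1, h2⟩ := hg ⟨h, hh⟩
    have h3 : (⟨_, h1⟩ * ⟨h, hh⟩⁻¹ : H) ∈ χ.1.ker := by
      rw [MonoidHom.mem_ker, map_mul, map_inv, mul_inv_eq_one]
      exact Units.ext h2.symm
    rw [χ.2] at h3
    exact h3
  -- the subgroup generated by `H` and `g` is again abelian modulo `K`
  set B := Subgroup.closure ((H : Set G) ∪ {g}) with hB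
  have hBK : B ≤ Subgroup.normalizer (K : Set G) := by
    rw [hB, Subgroup.closure_le, Set.union_subset_iff, Set.singleton_subset_iff]
    exact ⟨hHK, hgK⟩
  have hconj : ∀ x ∈ B, ∀ k ∈ K, x * k * x⁻¹ ∈ K := fun x hx k hk =>
    (Subgroup.mem_normalizer_iff.mp (hBK hx) k).mp hk
  have hconj' : ∀ x ∈ B, ∀ k ∈ K, x⁻¹ * k * x ∈ K := fun x hx k hk => by
    simpa using hconj x⁻¹ (inv_mem hx) k hk
  have hHB : H ≤ B := fun x hx => Subgroup.subset_closure (Or.inl hx)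
  have hBB : ⁅B, B⁆ ≤ K := by
    rw [Subgroup.commutator_le]
    intro x hx y hy
    induction hx, hy using Subgroup.closure_induction₂ with
    | mem x y hx hy =>
      rcases hx with hx | rfl <;> rcases hy with hy | rfl
      · exact hH (Subgroup.commutator_mem_commutator hx hy)
      · rw [← commutatorElement_inv]; exact inv_mem (hcomm x hx)
      · exact hcomm y hy
      · simp
    | one_left => simp
    | one_right => simp
    | mul_left x y z hx hy hz h1 h2 =>
      have e : ⁅x * y, z⁆ = x * ⁅y, z⁆ * x⁻¹ * ⁅x, z⁆ := by
        simp only [commutatorElement_def]; group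
      rw [e]
      exact mul_mem (hconj x hx _ h2) h1
    | mul_right y z x hy hz hx h1 h2 =>
      have e : ⁅x, y * z⁆ = ⁅x, y⁆ * (y * ⁅x, z⁆ * y⁻¹) := by
        simp only [commutatorElement_def]; group
      rw [e]
      exact mul_mem h1 (hconj y hy _ h2)
    | inv_left x y hx hy h1 =>
      have e : ⁅x⁻¹, y⁆ = x⁻¹ * ⁅x, y⁆⁻¹ * x := by
        simp only [commutatorElement_def]; group
      rw [e]
      exact hconj' x hx _ (inv_mem h1)
    | inv_right x y hx hy h1 =>
      have e : ⁅x, y⁻¹⁆ = y⁻¹ * ⁅x, y⁆⁻¹ * y := by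
        simp only [commutatorElement_def]; group
      rw [e]
      exact hconj' y hy _ (inv_mem h1)
  exact hP.le_of_ge ⟨hA.trans hHB, hBB, hK.trans hHB⟩ hHB
    (Subgroup.subset_closure (Or.inr rfl))

end ConjugateIdempotents

/-! ### The corner of `e_C` -/

section CornerIsomorphism

open MonoidAlgebra

variable {F : Type*} [Field F] {G : Type*} [Group G] {H K : Subgroup G}

/-- For every section `φ` the corner of `e_C` is the matrix algebra over the crossed product
attached to `φ`. -/
theorem exists_isAttached_algEquiv [Finite G] [CharZero F] [H.Normal]
    {χ : FaithfulChar F H K} (hK : K ≤ H)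
    (hχ : ∀ s : CycField F H K ≃ₐ[F] CycField F H K,
      (∀ h, s (χ.1 h : CycField F H K) = χ.1 h) → s = 1)
    (he : IsIdempotentElem (eClass (charClass χ)))
    (y : stabE (charClass χ)) (hy : (y : G) ∈ H)
    {φ : QuotEH (charClass χ) → QuotEK (charClass χ)} (hφ : IsSection (charClass χ) φ) :
    ∃ S : CrossedSystem F (CycField F H K) (QuotEH (charClass χ)),
      S.IsAttached φ y (χ.1 ⟨y, hy⟩ : CycField F H K) ∧
      Nonempty (he.Corner ≃ₐ[F]
        Matrix (Fin (stabE (charClass χ)).index) (Fin (stabE (charClass χ)).index)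
          (CrossedProduct S)) := by
  classical
  have := Fintype.ofFinite H
  let r : QuotEH (charClass χ) → stabE (charClass χ) := fun q => (φ q).out
  have hrφ : ∀ q, (r q : QuotEK (charClass χ)) = φ q := fun q => QuotientGroup.out_eq' _
  have hr : ∀ q, (r q : QuotEH (charClass χ)) = q := fun q => hφ q _ (hrφ q)
  -- elements of `H` in the same class modulo `K` have the same image under `χ`
  have hχK : ∀ (g : stabE (charClass χ)) (hg : (g : G) ∈ H) (i : ℤ),
      (g : QuotEK (charClass χ)) = (y : QuotEK (charClass χ)) ^ i →
      (χ.1 ⟨g, hg⟩ : CycField F H K) = (χ.1 ⟨y, hy⟩ : CycField F H K) ^ i := by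
    intro g hg i h
    rw [← QuotientGroup.mk_zpow, eq_comm, QuotientGroup.eq, Subgroup.mem_subgroupOf] at h
    have h1 : ((⟨y, hy⟩ : H) ^ i)⁻¹ * ⟨g, hg⟩ ∈ χ.1.ker := by
      rw [χ.2, Subgroup.mem_subgroupOf]
      exact h
    rw [MonoidHom.mem_ker, map_mul, map_inv, inv_mul_eq_one, map_zpow] at h1
    rw [← h1, Units.val_zpow_eq_zpow_val]
  obtain ⟨S, hσ, hτ⟩ := exists_crossedSystem hχ (fun g => (mem_stabE_iff χ hK).mp g.2) r hr
  refine ⟨S, ⟨fun q i h => ?_, fun p q j hj => ?_⟩, ?_⟩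
  · have hmem : (r q : G)⁻¹ * y * r q ∈ H := by
      have := Subgroup.Normal.conj_mem ‹H.Normal› _ hy (r q : G)⁻¹
      rwa [inv_inv] at this
    rw [(hσ q).apply_eq ⟨y, hy⟩ ⟨_, hmem⟩ rfl]
    refine hχK ((r q)⁻¹ * y * r q) hmem i ?_
    rw [← h, ← hrφ]
    rfl
  · obtain ⟨h, h1, h2⟩ := hτ p q
    have h3 : (r (p * q) : G)⁻¹ * (r p : G) * r q = h := by rw [mul_assoc, h1, inv_mul_cancel_left]
    have hmem : (r (p * q) : G)⁻¹ * (r p : G) * r q ∈ H := h3 ▸ h.2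
    rw [h2, show h = ⟨_, hmem⟩ from Subtype.ext h3.symm]
    refine hχK ((r (p * q))⁻¹ * r p * r q) hmem j ?_
    rw [← hj, ← hrφ, ← hrφ, ← hrφ]
    rfl
  · obtain ⟨g, hg, hg'⟩ := exists_leftCoset_representatives (stabE (charClass χ))
    obtain ⟨hinj, hsurj⟩ := crossedEmb_stabE hK hχ hr (S := S)
    have hid : charEmb χ.1 1 * charEmb χ.1 1 = charEmb (F := F) χ.1 1 := by
      rw [← charEmb_mul hχ, mul_one]
    have key : ∀ (e : MonoidAlgebra F G) (he : IsIdempotentElem e),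
        e = ∑ i, of F G (g i) * charEmb χ.1 1 * (charEmb χ.1 1 * of F G (g i)⁻¹) →
        Nonempty (he.Corner ≃ₐ[F] Matrix (Fin (stabE (charClass χ)).index)
          (Fin (stabE (charClass χ)).index) (CrossedProduct S)) := by
      rintro _ he rfl
      exact nonempty_corner_algEquiv_matrix _ (crossedEmb_mul hχ hσ hτ) (crossedEmb_one hτ) hinj
        hsurj (charEmb_matrixUnits hK hχ hg) (fun i => by rw [← mul_assoc, hid])
        (fun i => by rw [mul_assoc, hid]) he
    exact key _ he (eClass_eq_sum hK hχ hg hg')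

end CornerIsomorphism

/-! ### Existence of characters -/

section ExistenceOfCharacters

open MonoidAlgebra

variable {F : Type*} [Field F] {G : Type*} [Group G] [Finite G]

/-- A finite group of units of a field is cyclic, and the field generated by it is cyclotomic. -/
theorem isCyclic_and_nonempty_algEquiv_cycField [CharZero F] {L : Type*} [Field L] [Algebra F L]
    {B K : Subgroup G} (θ : B →* Lˣ)
    (hθ : Algebra.adjoin F (Set.range fun b => (θ b : L)) = ⊤) (hK : θ.ker = K.subgroupOf B) :
    (∃ _ : (K.subgroupOf B).Normal, IsCyclic (B ⧸ K.subgroupOf B)) ∧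
      Nonempty (L ≃ₐ[F] CycField F B K) := by
  have hn : (K.subgroupOf B).Normal := hK ▸ θ.normal_ker
  have hcard : Nat.card θ.range = K.relIndex B := by
    rw [← Subgroup.index_ker, hK]
    rfl
  have : Finite θ.range := Finite.of_surjective _ θ.rangeRestrict_surjective
  have hcyc : IsCyclic θ.range := isCyclic_subgroup_units _
  refine ⟨⟨hn, ?_⟩, ?_⟩
  · exact ((QuotientGroup.quotientMulEquivOfEq hK.symm).trans
      (QuotientGroup.quotientKerEquivRange θ)).isCyclic.mpr hcyc
  · have : IsCyclotomicExtension {K.relIndex B} F L := by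
      have : NeZero (K.relIndex B) := NeZero.of_neZero_natCast F
      refine (IsCyclotomicExtension.iff_singleton _ _ _).mpr ⟨?_, fun x => ?_⟩
      · obtain ⟨z, hz⟩ := hcyc.exists_generator
        refine ⟨z.1, IsPrimitiveRoot.coe_units_iff.mpr (IsPrimitiveRoot.iff_orderOf.mpr ?_)⟩
        rw [Subgroup.orderOf_coe, orderOf_eq_card_of_forall_mem_zpowers hz, hcard]
      · have h1 : x ∈ Algebra.adjoin F (Set.range fun b => (θ b : L)) := hθ ▸ trivial
        refine Algebra.adjoin_mono ?_ h1
        rintro _ ⟨b, rfl⟩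
        have h2 : (⟨θ b, b, rfl⟩ : θ.range) ^ Nat.card θ.range = 1 := pow_card_eq_one'
        rw [hcard] at h2
        have h3 := congrArg (fun z : θ.range => ((z : Lˣ) : L)) h2
        simpa using h3
    exact ⟨IsCyclotomicExtension.algEquiv {K.relIndex B} F L (CycField F B K)⟩

/-- The function `b B' ↦ b x` on the abelianization of `B`, for an element `x` of `FG` fixed by
`B'`. -/
noncomputable def abelianizationMul (B : Subgroup G) (x : MonoidAlgebra F G)
    (hx : ∀ k ∈ ⁅B, B⁆, of F G k * x = x) : Abelianization B → MonoidAlgebra F G :=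
  Quotient.lift (s := QuotientGroup.leftRel (commutator B)) (fun b => of F G (b : G) * x) (by
    intro a b hab
    have h1 : a⁻¹ * b ∈ commutator B := QuotientGroup.leftRel_apply.mp hab
    have h2 : ((a⁻¹ * b : B) : G) ∈ ⁅B, B⁆ := by
      rw [← Subgroup.map_subtype_commutator]
      exact ⟨_, h1, rfl⟩
    have h3 := hx _ h2
    change of F G (a : G) * x = of F G (b : G) * x
    conv_lhs => rw [← h3]
    rw [← mul_assoc, ← map_mul]
    simp)

/-- If the subgroup `K` of `B` contains `B'` and fixes `x ≠ 0`, then the idempotent of some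
character of `B` which is trivial on `K` does not annihilate `x`: such a character arises from a
maximal ideal of `F[B/B']` containing the annihilator of `x`. -/
theorem exists_epsChar_mul_ne_zero [CharZero F] {B K : Subgroup G} (hB : ⁅B, B⁆ ≤ K) (hK : K ≤ B)
    {x : MonoidAlgebra F G} (hx : x ≠ 0) (hKx : ∀ k ∈ K, of F G k * x = x) :
    ∃ K' : Subgroup G, K ≤ K' ∧ K' ≤ B ∧
      (∃ _ : (K'.subgroupOf B).Normal, IsCyclic (B ⧸ K'.subgroupOf B)) ∧
      ∃ χ : FaithfulChar F B K', epsChar χ * x ≠ 0 := by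
  classical
  have := Fintype.ofFinite B
  let lam := abelianizationMul B x fun k hk => hKx k (hB hk)
  have hlam : ∀ b : B, lam (Abelianization.of b) = of F G (b : G) * x := fun _ => rfl
  let Λ : MonoidAlgebra F (Abelianization B) →ₗ[F] MonoidAlgebra F G :=
    (Finsupp.linearCombination F lam).comp (coeffLinearEquiv F).toLinearMap
  have hΛ : ∀ (b : B) (c : F), Λ (single (Abelianization.of b) c) = c • (of F G (b : G) * x) :=
    fun b c => Finsupp.linearCombination_single F c (Abelianization.of b)
  have hΛmul : ∀ (b : B) (c : F) s,
      Λ (single (Abelianization.of b) c * s) = c • (of F G (b : G) * Λ s) := fun b c s => by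
    induction s using MonoidAlgebra.induction_linear with
    | zero => simp
    | add s t hs ht => rw [mul_add, map_add, hs, ht, map_add, mul_add, smul_add]
    | single q d =>
      obtain ⟨q, rfl⟩ := QuotientGroup.mk_surjective q
      change Λ (single (Abelianization.of b) c * single (Abelianization.of q) d) =
        c • (of F G (b : G) * Λ (single (Abelianization.of q) d))
      rw [single_mul_single, ← map_mul, hΛ, hΛ, mul_smul_comm, smul_smul, Subgroup.coe_mul, map_mul,
        mul_assoc]
  -- the annihilator of `x`
  let I : Ideal (MonoidAlgebra F (Abelianization B)) :=
    { carrier := {r | Λ r = 0}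
      add_mem' := fun {r s} (hr : Λ r = 0) (hs : Λ s = 0) => by
        change Λ (r + s) = 0
        rw [map_add, hr, hs, add_zero]
      zero_mem' := map_zero Λ
      smul_mem' := fun r s (hs : Λ s = 0) => by
        change Λ (r * s) = 0
        induction r using MonoidAlgebra.induction_linear with
        | zero => simp
        | add r t hr ht => rw [add_mul, map_add, hr, ht, add_zero]
        | single q d =>
          obtain ⟨q, rfl⟩ := QuotientGroup.mk_surjective q
          exact (hΛmul q d s).trans (by rw [hs, mul_zero, smul_zero]) }
  have hI : I ≠ ⊤ := fun h => hx <| by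
    have h1 : Λ (single (Abelianization.of 1) 1) = 0 := by
      have : single (Abelianization.of 1) 1 ∈ I := h ▸ trivial
      exact this
    rwa [hΛ, one_smul, Subgroup.coe_one, map_one (of F G), one_mul] at h1
  obtain ⟨m, hm, hIm⟩ := Ideal.exists_le_maximal I hI
  let _ : Field (MonoidAlgebra F (Abelianization B) ⧸ m) := Ideal.Quotient.field m
  let θ : B →* (MonoidAlgebra F (Abelianization B) ⧸ m)ˣ :=
    MonoidHom.toHomUnits (((Ideal.Quotient.mk m : _ →* _).comp
      (of F (Abelianization B))).comp Abelianization.of)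
  have hθ : ∀ b, (θ b : MonoidAlgebra F (Abelianization B) ⧸ m) =
      Ideal.Quotient.mk m (single (Abelianization.of b) 1) := fun _ => rfl
  have hker : θ.ker = (θ.ker.map B.subtype).subgroupOf B :=
    (Subgroup.comap_map_eq_self_of_injective B.subtype_injective _).symm
  have hsingle : ∀ (b : B) (c : F), Ideal.Quotient.mk m (single (Abelianization.of b) c) =
      c • (θ b : MonoidAlgebra F (Abelianization B) ⧸ m) := fun b c => by
    rw [hθ, ← Ideal.Quotient.mkₐ_eq_mk F, ← map_smul, smul_single, smul_eq_mul, mul_one]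
  have hadj : Algebra.adjoin F
      (Set.range fun b => (θ b : MonoidAlgebra F (Abelianization B) ⧸ m)) = ⊤ := by
    rw [eq_top_iff]
    rintro z -
    obtain ⟨z, rfl⟩ := Ideal.Quotient.mk_surjective z
    induction z using MonoidAlgebra.induction_linear with
    | zero => rw [map_zero]; exact zero_mem _
    | add r s hr hs => rw [map_add]; exact add_mem hr hs
    | single q d =>
      obtain ⟨q, rfl⟩ := QuotientGroup.mk_surjective q
      have h1 := hsingle q d
      change Ideal.Quotient.mk m (single (Abelianization.of q) d) ∈ _
      rw [h1]
      exact Subalgebra.smul_mem _ (Algebra.subset_adjoin (Set.mem_range_self q)) _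
  obtain ⟨⟨hn, hcyc⟩, ⟨f⟩⟩ := isCyclic_and_nonempty_algEquiv_cycField θ hadj hker
  set K' := θ.ker.map B.subtype with hK'
  refine ⟨K', ?_, Subgroup.map_subtype_le _, ⟨hn, hcyc⟩, ?_⟩
  · intro k hk
    refine Subgroup.mem_map.mpr ⟨⟨k, hK hk⟩, ?_, rfl⟩
    have h1 : single (Abelianization.of ⟨k, hK hk⟩) 1 - single (Abelianization.of 1) 1 ∈ m := by
      refine hIm ?_
      change Λ _ = 0
      rw [map_sub, hΛ, hΛ]
      simp only [one_smul, hKx k hk, Subgroup.coe_one, map_one, one_mul, sub_self]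
    rw [← Ideal.Quotient.eq, ← hθ, ← hθ, map_one] at h1
    exact Units.ext h1
  · let χ : FaithfulChar F B K' := ⟨(Units.map (f : _ →* _)).comp θ, by
      rw [← hker]
      ext b
      exact map_eq_one_iff _ (Units.map_injective f.injective)⟩
    have hχ : ∀ b, (χ.1 b : CycField F B K') = f (θ b) := fun _ => rfl
    refine ⟨χ, fun h0 => ?_⟩
    let c : B → F := fun b => (Nat.card B : F)⁻¹ *
      Algebra.trace F (CycField F B K') (1 * ((χ.1 b)⁻¹ : (CycField F B K')ˣ).1)
    have h1 : Λ (∑ b, single (Abelianization.of b) (c b)) = 0 := by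
      rw [← h0, epsChar_eq_charEmb_one, charEmb_apply, map_sum, Finset.sum_mul]
      refine Finset.sum_congr rfl fun b _ => ?_
      rw [hΛ, ← smul_mul_assoc]
      simp [c]
    have h2 : Ideal.Quotient.mk m (∑ b, single (Abelianization.of b) (c b)) = 0 :=
      Ideal.Quotient.eq_zero_iff_mem.mpr (hIm h1)
    have h3 := sum_trace_mul_inv_mul_self χ.eq_one_of_forall_apply_eq 1
    -- the element of `F[B/B']` inducing the idempotent of `χ` lies in `m`, but `f` maps it to `1`
    refine one_ne_zero (h3.symm.trans ?_)
    rw [← map_zero f, ← h2]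
    simp only [map_sum, hsingle, map_smul, hχ, c]

end ExistenceOfCharacters

/-! ### The primitive central idempotents of the group algebra -/

section Classification

open MonoidAlgebra

/-- Two primitive central idempotents which are not orthogonal are equal. -/
theorem IsPrimitiveCentralIdempotent.eq_of_mul_ne_zero {R : Type*} [Ring R] {e f : R}
    (he : IsPrimitiveCentralIdempotent e) (hf : IsPrimitiveCentralIdempotent f)
    (h : e * f ≠ 0) : e = f := by
  have key : ∀ {e f : R}, IsPrimitiveCentralIdempotent e → IsPrimitiveCentralIdempotent f →
      e * f ≠ 0 → e = e * f := by
    intro e f ⟨hei, hec, _, hep⟩ ⟨hfi, hfc, _, _⟩ h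
    have hcomm : f * e = e * f := Semigroup.mem_center_iff.mp hec f
    have h1 : e * f * (e * f) = e * f := by
      rw [mul_assoc, ← mul_assoc f, hcomm, mul_assoc, hfi.eq, ← mul_assoc, hei.eq]
    have h2 : e * (e * f) = e * f := by rw [← mul_assoc, hei.eq]
    have h3 : e * f * e = e * f := by rw [mul_assoc, hcomm, h2]
    have hc : e * f ∈ Set.center R := Set.mul_mem_center hec hfc
    have h4 := hep (e * f) (e - e * f) h1 hc
      (by rw [IsIdempotentElem, mul_sub, sub_mul, sub_mul, h1, h2, h3, hei.eq, sub_self, sub_zero])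
      (by rw [sub_eq_add_neg]; exact Set.add_mem_center hec (Set.neg_mem_center hc))
      (by rw [mul_sub, h3, h1, sub_self]) (by rw [add_sub_cancel])
    exact sub_eq_zero.mp (h4.resolve_left h)
  have hcomm : f * e = e * f := Semigroup.mem_center_iff.mp he.2.1 f
  rw [key he hf h, ← hcomm, ← key hf he (hcomm ▸ h)]

variable {F : Type*} [Field F] [CharZero F] {G : Type*} [Group G] [Finite G] {A : Subgroup G}

theorem IsCyclicMaximalPair.isPrimitiveCentralIdempotent (hGA : commutator G ≤ A)
    {H K : Subgroup G} (h : IsCyclicMaximalPair A H K) (C : CharClass F H K) :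
    IsPrimitiveCentralIdempotent (eClass C) := by
  obtain ⟨hP, hn, hc⟩ := h
  have : H.Normal := Subgroup.Normal.of_commutator_le G (hGA.trans hP.prop.1)
  obtain ⟨χ, rfl⟩ := Quotient.exists_rep C
  exact isPrimitiveCentralIdempotent_eClass hP.prop.2.2 χ.eq_one_of_forall_apply_eq
    fun g hg => mem_of_isTwist_refl hP χ hg

/-- Every primitive central idempotent `e` is some `e_C`: among the pairs `(B, χ)` with `A ≤ B`
such that the idempotent of `χ` does not annihilate `e`, one with `B` maximal yields `(H, K)`. -/
theorem IsPrimitiveCentralIdempotent.exists_eq_eClass [IsMulCommutative A]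
    (hGA : commutator G ≤ A) {e : MonoidAlgebra F G} (he : IsPrimitiveCentralIdempotent e) :
    ∃ H K : Subgroup G, IsCyclicMaximalPair A H K ∧ ∃ C : CharClass F H K, e = eClass C := by
  let s : Set (Subgroup G) := {B | A ≤ B ∧ ∃ K ≤ B, ⁅B, B⁆ ≤ K ∧
    (∃ _ : (K.subgroupOf B).Normal, IsCyclic (B ⧸ K.subgroupOf B)) ∧
    ∃ χ : FaithfulChar F B K, epsChar χ * e ≠ 0}
  have hs : s.Nonempty := by
    have hA : ⁅A, A⁆ ≤ ⊥ := (Subgroup.commutator_self_eq_bot_iff.mpr ‹_›).le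
    obtain ⟨K, -, hKA, hcyc, χ, hχ⟩ := exists_epsChar_mul_ne_zero hA bot_le he.2.2.1
      (fun k hk => by rw [Subgroup.mem_bot.mp hk, map_one, one_mul])
    exact ⟨A, le_rfl, K, hKA, hA.trans bot_le, hcyc, χ, hχ⟩
  obtain ⟨H, hH⟩ := s.toFinite.exists_maximal hs
  obtain ⟨hAH, K, hKH, hHK, hcyc, χ, hχ⟩ := hH.prop
  have := Fintype.ofFinite H
  have hP : IsCyclicMaximalPair A H K := by
    refine ⟨⟨⟨hAH, hHK, hKH⟩, fun B ⟨hAB, hBK, hKB⟩ hHB => ?_⟩, hcyc⟩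
    obtain ⟨K', hKK', hK'B, hcyc', χ', hχ'⟩ := exists_epsChar_mul_ne_zero hBK hKB hχ (by
      intro k hk
      have h1 : χ.1 ⟨k, hKH hk⟩ = 1 := by
        rw [← MonoidHom.mem_ker, χ.2, Subgroup.mem_subgroupOf]
        exact hk
      have h2 := of_mul_charEmb (F := F) χ.1 ⟨k, hKH hk⟩ 1
      rw [h1, Units.val_one, one_mul] at h2
      rw [← mul_assoc, epsChar_eq_charEmb_one, h2])
    refine hH.le_of_ge ⟨hAB, K', hK'B, hBK.trans hKK', hcyc', χ', fun h0 => hχ' ?_⟩ hHB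
    rw [Semigroup.mem_center_iff.mp he.2.1 (epsChar χ), ← mul_assoc, h0, zero_mul]
  refine ⟨H, K, hP, charClass χ, he.eq_of_mul_ne_zero (hP.isPrimitiveCentralIdempotent hGA _) ?_⟩
  intro h0
  have : H.Normal := Subgroup.Normal.of_commutator_le G (hGA.trans hAH)
  obtain ⟨hn, hc⟩ := hcyc
  apply hχ
  rw [epsChar_eq_charEmb_one, ← charEmb_one_mul_eClass hKH χ.eq_one_of_forall_apply_eq, mul_assoc,
    Semigroup.mem_center_iff.mp he.2.1, h0, mul_zero]

end Classification

theorem mainTheorem8 {F : Type*} [Field F] [NumberField F] {G : Type*} [Group G] [Finite G]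
    (hG : derivedSeries G 2 = ⊥)
    (A : Subgroup G) (hA : Maximal (fun B : Subgroup G => IsMulCommutative B) A)
    (hGA : commutator G ≤ A) :
    (∀ e : MonoidAlgebra F G, IsPrimitiveCentralIdempotent e →
      ∃ H K : Subgroup G, IsCyclicMaximalPair A H K ∧ ∃ C : CharClass F H K, e = eClass C) ∧
    (∀ H K : Subgroup G, IsCyclicMaximalPair A H K → ∀ C : CharClass F H K,
      IsPrimitiveCentralIdempotent (eClass C) ∧
      ∃ he : IsIdempotentElem (eClass C),
        ∀ χ : FaithfulChar F H K, charClass χ = C →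
        ∀ (y : stabE C) (hy : (y : G) ∈ H), K ⊔ Subgroup.zpowers (y : G) = H →
        ∀ ζ : CycField F H K, IsPrimitiveRoot ζ (K.relIndex H) → (χ.1 ⟨y, hy⟩ : CycField F H K) = ζ →
        ∀ φ : QuotEH C → QuotEK C, IsSection C φ →
          ∃ S : CrossedSystem F (CycField F H K) (QuotEH C), S.IsAttached φ y ζ ∧
            Nonempty (he.Corner ≃ₐ[F]
              Matrix (Fin (stabE C).index) (Fin (stabE C).index) (CrossedProduct S))) := by
  have hAc : IsMulCommutative A := hA.prop
  refine ⟨fun e he => he.exists_eq_eClass hGA, fun H K h C => ?_⟩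
  have hprim := h.isPrimitiveCentralIdempotent hGA C
  refine ⟨hprim, hprim.1, ?_⟩
  rintro χ rfl y hy - _ - rfl φ hφ
  obtain ⟨hP, hn, hc⟩ := h
  have : H.Normal := Subgroup.Normal.of_commutator_le G (hGA.trans hP.prop.1)
  exact exists_isAttached_algEquiv hP.prop.2.2 χ.eq_one_of_forall_apply_eq hprim.1 y hy hφ
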